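/- Let $G$ be a countable group. A length function on $G$ is a map $l:G\to[0,\infty)$ with $l(e)=0$, $l(g^{-1})=l(g)$ and $l(gh)\le l(g)+l(h)$. A function $f:\mathbb N\to[0,\infty)$ is subexponential if $\lim_{n\to\infty} f(n)^{1/n}=1$. The group $G$ has SD (subexponential decay) with respect to $l$ if there is a subexponential $f$ such that $\|x\|\le f(D)\,\|x\|_2$ for every $D\in\mathbb N$ and every $x\in\mathbb C[G]$ supported on $\{g: l(g)\le D\}$; here $\|x\|$ is the norm of $x$ as an operator on $\ell^2(G)$ in the left regular representation and $\|x\|_2=(\sum_g|x(g)|^2)^{1/2}$. The group $G$ has SD if it has SD with respect to some length function. Let $\Gamma=(V,E)$ be a finite simplicial graph, let $(G_v)_{v\in V}$ be groups, and let $G=G(\Gamma,G_v,v\in V)$ be their graph product: the quotient of the free product of the $G_v$ by the normal subgroup generated by the commutators $[a,b]$ with $a\in G_v$, $b\in G_w$ and $v,w$ adjacent. An expression $g=y_1\cdots y_k$ with $y_j\in G_{v_j}$ is reduced if $k$ is minimal among all expressions of $g$. **Theorem.** (1) If every vertex group $G_v$ has SD, then $G$ has SD. (2) Suppose that each $G_v$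 has SD with respect to a length function $l_v$ that is bounded below by a positive constant on $G_v\setminus\{e\}$ (for instance, an integer-valued length function vanishing only at $e$). Then $$l_G(g)=\sum_{j=1}^k l_{v_j}(y_j)\qquad(g=y_1\cdots y_k \text{ a reduced expression, } y_j\in G_{v_j})$$ is a well-defined length function on $G$, and $G$ has SD with respect to $l_G$. -/

import Mathlib

open scoped NNReal ENNReal
open Filter Topology

universe u v w

noncomputable section

namespace SubexpDecay

/-! ### The left regular representation and the two norms on `ℂ[G]` -/

/-- The Hilbert space `ℓ²(G)`. -/
abbrev L2 (G : Type u) : Type u := lp (fun _ : G => ℂ) 2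

theorem memLp_translate {G : Type u} [Group G] (g : G) (ξ : L2 G) :
    Memℓp (fun h : G => (ξ : G → ℂ) (g⁻¹ * h)) 2 := by
  have h2 : 0 < (2 : ℝ≥0∞).toReal := by norm_num
  exact (memℓp_gen_iff h2).2
    ((Equiv.mulLeft g⁻¹).summable_iff.2 ((memℓp_gen_iff h2).1 (lp.memℓp ξ)))

/-- Left translation `(λ(g) ξ)(h) = ξ(g⁻¹ h)` on `ℓ²(G)`, an isometry. -/
def leftTranslation {G : Type u} [Group G] (g : G) : L2 G →ₗᵢ[ℂ] L2 G where
  toFun ξ := ⟨fun h => (ξ : G → ℂ) (g⁻¹ * h), memLp_translate g ξ⟩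
  map_add' _ _ := rfl
  map_smul' _ _ := rfl
  norm_map' ξ := by
    have h2 : 0 < (2 : ℝ≥0∞).toReal := by norm_num
    rw [lp.norm_eq_tsum_rpow h2, lp.norm_eq_tsum_rpow h2]
    congr 1
    exact (Equiv.mulLeft g⁻¹).tsum_eq (fun h => ‖(ξ : G → ℂ) h‖ ^ (2 : ℝ≥0∞).toReal)

@[simp] theorem leftTranslation_apply {G : Type u} [Group G] (g : G) (ξ : L2 G) (h : G) :
    (leftTranslation g ξ : G → ℂ) h = (ξ : G → ℂ) (g⁻¹ * h) := rfl

/-- The operator `λ(x) = ∑ g, x(g) λ(g)` on `ℓ²(G)`, for `x ∈ ℂ[G]`. -/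
def regularRep {G : Type u} [Group G] (x : MonoidAlgebra ℂ G) : L2 G →L[ℂ] L2 G :=
  ∑ g ∈ x.coeff.support, x.coeff g • (leftTranslation g).toContinuousLinearMap

/-- The operator norm `‖x‖ = ‖λ(x)‖` of `x ∈ ℂ[G]`. -/
def opNorm {G : Type u} [Group G] (x : MonoidAlgebra ℂ G) : ℝ := ‖regularRep x‖

/-- The `2`-norm `‖x‖₂ = (∑ g, |x(g)|²) ^ (1/2)` of `x ∈ ℂ[G]`. -/
def twoNorm {G : Type u} (x : MonoidAlgebra ℂ G) : ℝ :=
  √(∑ g ∈ x.coeff.support, ‖x.coeff g‖ ^ 2)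

/-! ### Subexponential decay

A length function on `G` is a `GroupSeminorm G`: a function `l : G → ℝ` with `l 1 = 0`,
`l g⁻¹ = l g` and `l (g * h) ≤ l g + l h` (it is then automatically nonnegative). -/

/-- `f : ℕ → [0, ∞)` is subexponential if `f(n) ^ (1/n) → 1`. -/
def IsSubexponential (f : ℕ → ℝ≥0) : Prop :=
  Tendsto (fun n : ℕ => f n ^ (1 / (n : ℝ))) atTop (𝓝 1)

/-- `f` is a decay function for `(G, l)`: `‖x‖ ≤ f(D) ‖x‖₂` for every `x ∈ ℂ[G]` supported on the
`l`-ball of radius `D`. -/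
def IsDecayFunction {G : Type u} [Group G] (l : GroupSeminorm G) (f : ℕ → ℝ≥0) : Prop :=
  ∀ (D : ℕ) (x : MonoidAlgebra ℂ G), (∀ g ∈ x.coeff.support, l g ≤ D) →
    opNorm x ≤ f D * twoNorm x

/-- `G` is a countable group that has property SD with respect to the length function `l`. -/
def HasSDWith {G : Type u} [Group G] (l : GroupSeminorm G) : Prop :=
  Countable G ∧ ∃ f : ℕ → ℝ≥0, IsSubexponential f ∧ IsDecayFunction l f

/-- `G` is a countable group that has property SD. -/
def HasSD (G : Type u) [Group G] : Prop :=
  ∃ l : GroupSeminorm G, HasSDWith l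

/-! ### Graph products -/

/-- The commutators `a b a⁻¹ b⁻¹` in the free product, `a` and `b` in adjacent vertex groups. -/
def graphRelators {V : Type v} (Γ : SimpleGraph V) (G : V → Type w) [∀ i, Group (G i)] :
    Set (Monoid.CoprodI G) :=
  {r | ∃ (i j : V) (a : G i) (b : G j), Γ.Adj i j ∧
    r = Monoid.CoprodI.of a * Monoid.CoprodI.of b * (Monoid.CoprodI.of a)⁻¹ *
      (Monoid.CoprodI.of b)⁻¹}

/-- The graph product `G(Γ, G_v, v ∈ V)`: the quotient of the free product of the vertex groups in
which the groups of adjacent vertices commute. -/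
abbrev GraphProduct {V : Type v} (Γ : SimpleGraph V) (G : V → Type w) [∀ i, Group (G i)] :
    Type (max v w) :=
  Monoid.CoprodI G ⧸ Subgroup.normalClosure (graphRelators Γ G)

/-- The canonical map of a vertex group to the graph product. -/
def GraphProduct.of {V : Type v} (Γ : SimpleGraph V) {G : V → Type w} [∀ i, Group (G i)] (i : V) :
    G i →* GraphProduct Γ G :=
  (QuotientGroup.mk' (Subgroup.normalClosure (graphRelators Γ G))).comp Monoid.CoprodI.of

/-- The element `y₁ ⋯ y_k` of the graph product given by an expression, that is, a finite
sequence of syllables `y_j`, each in a vertex group `G_{v_j}`. -/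
def GraphProduct.eval {V : Type v} (Γ : SimpleGraph V) {G : V → Type w} [∀ i, Group (G i)]
    (e : List (Σ i, G i)) : GraphProduct Γ G :=
  (e.map fun y => GraphProduct.of Γ y.1 y.2).prod

/-- An expression is reduced if no expression of the same element has fewer syllables. -/
def GraphProduct.IsReduced {V : Type v} (Γ : SimpleGraph V) {G : V → Type w} [∀ i, Group (G i)]
    (e : List (Σ i, G i)) : Prop :=
  ∀ e' : List (Σ i, G i), GraphProduct.eval Γ e' = GraphProduct.eval Γ e → e.length ≤ e'.length

end SubexpDecay

end

/-!
The graph product acts on irreducible expressions modulo exchanges of neighbouring commuting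
syllables (van der Waerden's trick); acting on the empty expression shows that irreducible
expressions of an element are unique up to such exchanges, so the sum of the syllable lengths is
well defined.

Cancelling in a product `g h` of irreducible expressions gives `g = a s c`, `h = c⁻¹ t b` and
`g h = a (s t) b`, where `s` and `t` lie in the product of the vertex groups of a clique. For a
fixed clique and fixed numbers of syllables in the left factor, an element determines its splitting,
and if `g` has at most `k` syllables there are only polynomially many choices in `k`. Summing over
`s` and `t` first, with the convolution bound of a finite product of vertex groups, and then
applying the Cauchy–Schwarz inequality over `a`, `b`, `c`, one bounds convolution by functions
supported on a ball of the graph product by a polynomial in `k` times the product of the vertex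
bounds. If the vertex lengths are bounded below away from the identity, `k` is linear in the radius
of the ball. Arbitrary vertex lengths are first replaced by `l + 1` off the identity, which only
shrinks balls.
-/

noncomputable section

namespace SubexpDecay

namespace GraphProduct

/-! ### Expressions up to shuffling -/

section Shuffle

variable {V : Type v} {Γ : SimpleGraph V} {G : V → Type w} {e f : List (Σ i, G i)}

variable (Γ) in
/-- Two expressions are shuffles of each other if they differ by exchanges of consecutive
syllables in adjacent vertex groups. -/
inductive Shuffle : List (Σ i, G i) → List (Σ i, G i) → Prop
  | nil : Shuffle [] []
  | cons (y : Σ i, G i) {e f : List (Σ i, G i)} : Shuffle e f → Shuffle (y :: e) (y :: f)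
  | swap {y z : Σ i, G i} (e : List (Σ i, G i)) : Γ.Adj y.1 z.1 →
      Shuffle (y :: z :: e) (z :: y :: e)
  | trans {e f g : List (Σ i, G i)} : Shuffle e f → Shuffle f g → Shuffle e g

theorem Shuffle.refl : ∀ e : List (Σ i, G i), Shuffle Γ e e
  | [] => .nil
  | y :: e => .cons y (Shuffle.refl e)

theorem Shuffle.symm (h : Shuffle Γ e f) : Shuffle Γ f e := by
  induction h with
  | nil => exact .nil
  | cons y _ ih => exact .cons y ih
  | swap e h => exact .swap e h.symm
  | trans _ _ h₁ h₂ => exact h₂.trans h₁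

theorem Shuffle.append_left (p : List (Σ i, G i)) (h : Shuffle Γ e f) :
    Shuffle Γ (p ++ e) (p ++ f) := by
  induction p with
  | nil => exact h
  | cons y p ih => exact .cons y ih

theorem Shuffle.cons_append {y : Σ i, G i} {x : List (Σ i, G i)}
    (h : ∀ z ∈ x, Γ.Adj z.1 y.1) (e : List (Σ i, G i)) :
    Shuffle Γ (y :: (x ++ e)) (x ++ y :: e) := by
  induction x with
  | nil => exact .refl _
  | cons z x ih =>
    obtain ⟨hz, hx⟩ := List.forall_mem_cons.1 h
    exact (Shuffle.swap _ hz.symm).trans (.cons z (ih hx))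

theorem Shuffle.perm (h : Shuffle Γ e f) : e.Perm f := by
  induction h with
  | nil => exact .nil
  | cons y _ ih => exact ih.cons y
  | swap e _ => exact .swap _ _ _
  | trans _ _ h₁ h₂ => exact h₁.trans h₂

open Classical in
/-- The projection of an expression to the syllables in two given vertex groups. -/
def restrict (u v : V) (e : List (Σ i, G i)) : List (Σ i, G i) :=
  e.filter fun y => y.1 = u ∨ y.1 = v

theorem mem_restrict {u v : V} {y : Σ i, G i} :
    y ∈ restrict u v e ↔ y ∈ e ∧ (y.1 = u ∨ y.1 = v) := by
  simp [restrict]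

theorem restrict_append (u v : V) (e f : List (Σ i, G i)) :
    restrict u v (e ++ f) = restrict u v e ++ restrict u v f := by
  simp [restrict]

theorem restrict_cons_of_eq {u v : V} {y : Σ i, G i} (h : y.1 = u ∨ y.1 = v)
    (e : List (Σ i, G i)) : restrict u v (y :: e) = y :: restrict u v e := by
  simp [restrict, h]

theorem restrict_cons_of_ne {u v : V} {y : Σ i, G i} (h : ¬ (y.1 = u ∨ y.1 = v))
    (e : List (Σ i, G i)) : restrict u v (y :: e) = restrict u v e := by
  simp [restrict, h]

theorem length_restrict_eq_of_perm (h : (e.map Sigma.fst).Perm (f.map Sigma.fst)) (u v : V) :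
    (restrict u v e).length = (restrict u v f).length := by
  classical
  have length_eq (e : List (Σ i, G i)) : (restrict u v e).length =
      ((e.map Sigma.fst).filter fun i => i = u ∨ i = v).length := by
    rw [List.filter_map, List.length_map]
    simp [restrict, Function.comp_def]
  rw [length_eq, length_eq]
  exact (h.filter _).length_eq

theorem Shuffle.restrict_eq (h : Shuffle Γ e f) {u v : V} (huv : ¬ Γ.Adj u v) :
    restrict u v e = restrict u v f := by
  induction h with
  | nil => rfl
  | cons y _ ih => simp only [restrict, List.filter_cons] at ih ⊢; rw [ih]
  | @swap y z e h =>
    by_cases hy : y.1 = u ∨ y.1 = v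
    · have hz : ¬ (z.1 = u ∨ z.1 = v) := by
        rintro hz
        rcases hy with hy | hy <;> rcases hz with hz | hz <;> rw [hy, hz] at h
        exacts [Γ.irrefl h, huv h, huv h.symm, Γ.irrefl h]
      rw [restrict_cons_of_eq hy, restrict_cons_of_ne hz, restrict_cons_of_ne hz,
        restrict_cons_of_eq hy]
    · simp only [restrict, List.filter_cons, hy, decide_false, Bool.false_eq_true, if_false]
  | trans _ _ h₁ h₂ => exact h₁.trans h₂

theorem eq_nil_of_restrict_eq_nil (h : ∀ v, restrict v v e = []) : e = [] :=
  List.eq_nil_iff_forall_not_mem.2 fun y hy => by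
    simpa [h] using mem_restrict (u := y.1) (v := y.1).2 ⟨hy, .inl rfl⟩

/-- The first `y.1`-syllable of `f` is `y`, and it can be shuffled to the front: a syllable `z`
before it with `z.1` not adjacent to `y.1` would precede `y` in the projection to `z.1, y.1`. -/
theorem exists_shuffle_cons_of_restrict_eq {y : Σ i, G i}
    (h : ∀ u v, ¬ Γ.Adj u v → restrict u v (y :: e) = restrict u v f) :
    ∃ f', Shuffle Γ (y :: f') f := by
  have hy : restrict y.1 y.1 f = y :: restrict y.1 y.1 e := by
    rw [← h y.1 y.1 Γ.irrefl, restrict_cons_of_eq (.inl rfl)]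
  obtain ⟨r, s, rfl, hr, -, -⟩ := List.filter_eq_cons_iff.1 hy
  refine ⟨r ++ s, .cons_append (fun z hz => ?_) s⟩
  by_contra hzy
  have heq := h z.1 y.1 hzy
  rw [restrict_cons_of_eq (.inr rfl), restrict_append] at heq
  have hz' : z ∈ restrict z.1 y.1 r := mem_restrict.2 ⟨hz, .inl rfl⟩
  obtain ⟨t, l, htl⟩ := List.exists_cons_of_ne_nil (List.ne_nil_of_mem hz')
  rw [htl, List.cons_append, List.cons.injEq] at heq
  have htr : t ∈ restrict z.1 y.1 r := by simp [htl]
  have hty : t.1 ≠ y.1 := fun h => hr t (mem_restrict.1 htr).1 (by simp [h])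
  exact hty (by rw [heq.1])

theorem shuffle_of_restrict_eq (h : ∀ u v, ¬ Γ.Adj u v → restrict u v e = restrict u v f) :
    Shuffle Γ e f := by
  induction e generalizing f with
  | nil =>
    rw [eq_nil_of_restrict_eq_nil fun v => (h v v Γ.irrefl).symm]
    exact .nil
  | cons y e ih =>
    obtain ⟨f', hf'⟩ := exists_shuffle_cons_of_restrict_eq h
    refine (Shuffle.cons y (ih fun u v huv => ?_)).trans hf'
    have heq := (h u v huv).trans (hf'.restrict_eq huv).symm
    by_cases hy : y.1 = u ∨ y.1 = v
    · rw [restrict_cons_of_eq hy, restrict_cons_of_eq hy] at heq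
      exact (List.cons.inj heq).2
    · rwa [restrict_cons_of_ne hy, restrict_cons_of_ne hy] at heq

theorem Shuffle.of_append {p p' r r' : List (Σ i, G i)} (h : Shuffle Γ (p ++ r) (p' ++ r'))
    (hp : (p.map Sigma.fst).Perm (p'.map Sigma.fst)) : Shuffle Γ p p' ∧ Shuffle Γ r r' := by
  have hrestrict (u v : V) (huv : ¬ Γ.Adj u v) :
      restrict u v p = restrict u v p' ∧ restrict u v r = restrict u v r' := by
    have heq := h.restrict_eq huv
    rw [restrict_append, restrict_append] at heq
    exact List.append_inj heq (length_restrict_eq_of_perm hp u v)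
  exact ⟨shuffle_of_restrict_eq fun u v huv => (hrestrict u v huv).1,
    shuffle_of_restrict_eq fun u v huv => (hrestrict u v huv).2⟩

end Shuffle

/-! ### Irreducible expressions -/

section Front

variable {V : Type v} (Γ : SimpleGraph V) {G : V → Type w}

theorem front_induction (v : V) {motive : List (Σ i, G i) → Prop} (nil : motive [])
    (self : ∀ a e, motive (⟨v, a⟩ :: e))
    (adj : ∀ y e, Γ.Adj y.1 v → motive e → motive (y :: e))
    (blocked : ∀ y e, y.1 ≠ v → ¬ Γ.Adj y.1 v → motive (y :: e)) (e : List (Σ i, G i)) :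
    motive e := by
  induction e with
  | nil => exact nil
  | cons y e ih =>
    by_cases hself : y.1 = v
    · subst hself
      exact self y.2 e
    by_cases hadj : Γ.Adj y.1 v
    exacts [adj y e hadj ih, blocked y e hself hadj]

open Classical in
/-- The expression with its front `v`-syllable deleted. -/
def tail (v : V) : List (Σ i, G i) → List (Σ i, G i)
  | [] => []
  | y :: e => if y.1 = v then e else if Γ.Adj y.1 v then y :: tail v e else y :: e

@[simp] theorem tail_nil (v : V) : tail Γ v ([] : List (Σ i, G i)) = [] := rfl

@[simp] theorem tail_cons_self (v : V) (a : G v) (e : List (Σ i, G i)) :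
    tail Γ v (⟨v, a⟩ :: e) = e := by simp [tail]

variable {Γ}

theorem tail_cons_adj {v : V} {y : Σ i, G i} (h : Γ.Adj y.1 v) (e : List (Σ i, G i)) :
    tail Γ v (y :: e) = y :: tail Γ v e := by simp [tail, h, h.ne]

theorem tail_cons_blocked {v : V} {y : Σ i, G i} (h : y.1 ≠ v) (h' : ¬ Γ.Adj y.1 v)
    (e : List (Σ i, G i)) : tail Γ v (y :: e) = y :: e := by simp [tail, h, h']

theorem Shuffle.tail {e f : List (Σ i, G i)} (h : Shuffle Γ e f) (v : V) :
    Shuffle Γ (tail Γ v e) (tail Γ v f) := by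
  induction h with
  | nil => exact .nil
  | cons y h ih =>
    simp only [GraphProduct.tail]
    split_ifs
    exacts [h, .cons y ih, .cons y h]
  | @swap y z e h =>
    obtain ⟨i, a⟩ := y
    obtain ⟨j, b⟩ := z
    by_cases hi : i = v
    · subst hi
      rw [tail_cons_self, tail_cons_adj h.symm, tail_cons_self]
      exact .refl _
    by_cases hj : j = v
    · subst hj
      rw [tail_cons_self, tail_cons_adj h, tail_cons_self]
      exact .refl _
    simp only [GraphProduct.tail, hi, hj, if_false]
    split_ifs <;> exact .swap _ h
  | trans _ _ h₁ h₂ => exact h₁.trans h₂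

theorem tail_comm_of_adj {u v : V} (h : Γ.Adj u v) (e : List (Σ i, G i)) :
    tail Γ u (tail Γ v e) = tail Γ v (tail Γ u e) := by
  induction e with
  | nil => rfl
  | cons y e ih =>
    obtain ⟨i, a⟩ := y
    by_cases hiv : i = v
    · subst hiv
      rw [tail_cons_self, tail_cons_adj h.symm, tail_cons_self]
    by_cases hiu : i = u
    · subst hiu
      rw [tail_cons_self, tail_cons_adj h, tail_cons_self]
    simp only [tail, hiv, hiu, if_false]
    split_ifs <;> simp [tail, *]

variable [∀ i, One (G i)]

variable (Γ) in
open Classical in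
/-- The front `v`-syllable of an expression: the first `v`-syllable, if everything before it is
adjacent to `v`, and `1` if there is no such syllable. -/
def head (v : V) : List (Σ i, G i) → G v
  | [] => 1
  | y :: e => if h : y.1 = v then h ▸ y.2 else if Γ.Adj y.1 v then head v e else 1

variable (Γ) in
@[simp] theorem head_nil (v : V) : head Γ v ([] : List (Σ i, G i)) = 1 := rfl

variable (Γ) in
@[simp] theorem head_cons_self (v : V) (a : G v) (e : List (Σ i, G i)) :
    head Γ v (⟨v, a⟩ :: e) = a := by simp [head]

theorem head_cons_adj {v : V} {y : Σ i, G i} (h : Γ.Adj y.1 v) (e : List (Σ i, G i)) :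
    head Γ v (y :: e) = head Γ v e := by simp [head, h, h.ne]

theorem head_cons_blocked {v : V} {y : Σ i, G i} (h : y.1 ≠ v) (h' : ¬ Γ.Adj y.1 v)
    (e : List (Σ i, G i)) : head Γ v (y :: e) = 1 := by simp [head, h, h']

theorem head_append_of_adj {v : V} {x : List (Σ i, G i)} (h : ∀ y ∈ x, Γ.Adj y.1 v)
    (e : List (Σ i, G i)) : head Γ v (x ++ e) = head Γ v e := by
  induction x with
  | nil => rfl
  | cons y x ih =>
    obtain ⟨hy, hx⟩ := List.forall_mem_cons.1 h
    rw [List.cons_append, head_cons_adj hy, ih hx]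

theorem head_append_of_not_adj {v : V} {x : List (Σ i, G i)} (h : ¬ ∀ y ∈ x, Γ.Adj y.1 v)
    (e : List (Σ i, G i)) : head Γ v (x ++ e) = head Γ v x := by
  induction x with
  | nil => simp at h
  | cons y x ih =>
    simp only [List.cons_append, head]
    split_ifs with hself hadj
    · rfl
    · exact ih fun h' => h (List.forall_mem_cons.2 ⟨hadj, h'⟩)
    · rfl

theorem head_tail_of_adj {u v : V} (h : Γ.Adj u v) (e : List (Σ i, G i)) :
    head Γ u (tail Γ v e) = head Γ u e := by
  induction e using front_induction Γ v with
  | nil => rfl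
  | self a e => rw [tail_cons_self, head_cons_adj h.symm]
  | adj y e hy ih =>
    rw [tail_cons_adj hy]
    simp only [head, ih]
  | blocked y e hv hadj => rw [tail_cons_blocked hv hadj]

theorem Shuffle.head_eq {e f : List (Σ i, G i)} (h : Shuffle Γ e f) (v : V) :
    head Γ v e = head Γ v f := by
  induction h with
  | nil => rfl
  | cons y _ ih => simp only [head, ih]
  | @swap y z e h =>
    obtain ⟨i, a⟩ := y
    obtain ⟨j, b⟩ := z
    by_cases hi : i = v
    · subst hi
      rw [head_cons_self, head_cons_adj h.symm, head_cons_self]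
    by_cases hj : j = v
    · subst hj
      rw [head_cons_self, head_cons_adj h, head_cons_self]
    simp only [head, hi, hj, dite_false]
    split_ifs <;> rfl
  | trans _ _ h₁ h₂ => exact h₁.trans h₂

theorem shuffle_cons_head_tail {v : V} {e : List (Σ i, G i)} (h : head Γ v e ≠ 1) :
    Shuffle Γ e (⟨v, head Γ v e⟩ :: tail Γ v e) := by
  induction e using front_induction Γ v with
  | nil => simp at h
  | self a e => simpa using Shuffle.refl _
  | adj y e hy ih =>
    rw [head_cons_adj hy] at h ⊢
    rw [tail_cons_adj hy]
    exact ((ih h).cons y).trans (.swap _ hy)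
  | blocked y e hv hadj => exact absurd (head_cons_blocked hv hadj e) h

end Front

section Irreducible

variable {V : Type v} (Γ : SimpleGraph V) {G : V → Type w} [∀ i, One (G i)]

/-- An expression is irreducible if its syllables are nontrivial and no two of them can be
merged after shuffling. -/
def IsIrreducible : List (Σ i, G i) → Prop
  | [] => True
  | y :: e => y.2 ≠ 1 ∧ head Γ y.1 e = 1 ∧ IsIrreducible e

variable {Γ} {e f : List (Σ i, G i)}

theorem IsIrreducible.ne_one (he : IsIrreducible Γ e) : ∀ y ∈ e, y.2 ≠ 1 := by
  induction e with
  | nil => simp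
  | cons y e ih => exact List.forall_mem_cons.2 ⟨he.1, ih he.2.2⟩

theorem Shuffle.isIrreducible (h : Shuffle Γ e f) (he : IsIrreducible Γ e) :
    IsIrreducible Γ f := by
  induction h with
  | nil => exact he
  | cons y h ih => exact ⟨he.1, (h.head_eq _).symm.trans he.2.1, ih he.2.2⟩
  | swap e h =>
    obtain ⟨hy, hye, hz, hze, he⟩ := he
    rw [head_cons_adj h.symm] at hye
    exact ⟨hz, by rwa [head_cons_adj h], hy, hye, he⟩
  | trans _ _ h₁ h₂ => exact h₂ (h₁ he)

theorem IsIrreducible.tail_eq_self {v : V} (he : IsIrreducible Γ e) (h : head Γ v e = 1) :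
    GraphProduct.tail Γ v e = e := by
  induction e using front_induction Γ v with
  | nil => rfl
  | self a e => exact absurd (by simpa using h) he.1
  | adj y e hy ih =>
    rw [head_cons_adj hy] at h
    rw [tail_cons_adj hy, ih he.2.2 h]
  | blocked y e hv hadj => exact tail_cons_blocked hv hadj e

theorem IsIrreducible.head_tail (he : IsIrreducible Γ e) (v : V) :
    head Γ v (tail Γ v e) = 1 := by
  induction e using front_induction Γ v with
  | nil => rfl
  | self a e =>
    rw [tail_cons_self]
    exact he.2.1
  | adj y e hy ih => rw [tail_cons_adj hy, head_cons_adj hy, ih he.2.2]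
  | blocked y e hv hadj => rw [tail_cons_blocked hv hadj, head_cons_blocked hv hadj]

theorem IsIrreducible.tail (he : IsIrreducible Γ e) (v : V) :
    IsIrreducible Γ (tail Γ v e) := by
  by_cases h : head Γ v e = 1
  · rwa [he.tail_eq_self h]
  · exact ((shuffle_cons_head_tail h).isIrreducible he).2.2

theorem IsIrreducible.replace {v : V} {b b' : G v} {x y : List (Σ i, G i)}
    (h : IsIrreducible Γ (x ++ ⟨v, b⟩ :: y)) (hb' : b' ≠ 1) :
    IsIrreducible Γ (x ++ ⟨v, b'⟩ :: y) := by
  have hb : b ≠ 1 := h.ne_one ⟨v, b⟩ (by simp)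
  induction x with
  | nil => exact ⟨hb', h.2⟩
  | cons z x ih =>
    rw [List.cons_append] at h ⊢
    obtain ⟨hz, hhead, htail⟩ := h
    refine ⟨hz, ?_, ih htail⟩
    by_cases hx : ∀ w ∈ x, Γ.Adj w.1 z.1
    · rw [head_append_of_adj hx] at hhead ⊢
      by_cases hv : v = z.1
      · subst hv
        exact absurd (by simpa using hhead) hb
      · simpa only [head, hv, dite_false] using hhead
    · rwa [head_append_of_not_adj hx] at hhead ⊢

theorem IsIrreducible.erase {y : Σ i, G i} {x : List (Σ i, G i)}
    (h : IsIrreducible Γ (x ++ y :: e)) (hx : ∀ z ∈ x, Γ.Adj z.1 y.1) :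
    IsIrreducible Γ (x ++ e) :=
  ((Shuffle.cons_append hx e).symm.isIrreducible h).2.2

end Irreducible

section Push

variable {V : Type v} {Γ : SimpleGraph V} {G : V → Type w} [∀ i, One (G i)]
  {e f : List (Σ i, G i)}

open Classical in
/-- An expression with a syllable added in front, unless the syllable is trivial. -/
def push (v : V) (a : G v) (e : List (Σ i, G i)) : List (Σ i, G i) :=
  if a = 1 then e else ⟨v, a⟩ :: e

@[simp] theorem push_one (v : V) (e : List (Σ i, G i)) : push v 1 e = e := if_pos rfl

theorem push_of_ne_one {v : V} {a : G v} (h : a ≠ 1) (e : List (Σ i, G i)) :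
    push v a e = ⟨v, a⟩ :: e := if_neg h

theorem Shuffle.push (h : Shuffle Γ e f) (v : V) (a : G v) :
    Shuffle Γ (push v a e) (push v a f) := by
  unfold GraphProduct.push
  split_ifs
  exacts [h, .cons _ h]

theorem shuffle_push_comm {u v : V} (h : Γ.Adj u v) (a : G u) (b : G v)
    (e : List (Σ i, G i)) : Shuffle Γ (push u a (push v b e)) (push v b (push u a e)) := by
  unfold push
  split_ifs
  exacts [.refl _, .refl _, .refl _, .swap e h]

theorem head_push_of_adj {u v : V} (h : Γ.Adj v u) (a : G v) (e : List (Σ i, G i)) :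
    head Γ u (push v a e) = head Γ u e := by
  unfold push
  split_ifs
  exacts [rfl, head_cons_adj h e]

theorem tail_push_of_adj {u v : V} (h : Γ.Adj v u) (a : G v) (e : List (Σ i, G i)) :
    tail Γ u (push v a e) = push v a (tail Γ u e) := by
  unfold push
  split_ifs
  exacts [rfl, tail_cons_adj h e]

theorem head_push {v : V} (h : head Γ v e = 1) (a : G v) : head Γ v (push v a e) = a := by
  unfold push
  split_ifs with ha
  exacts [h.trans ha.symm, head_cons_self Γ v a e]

theorem IsIrreducible.tail_push {v : V} (he : IsIrreducible Γ e) (h : head Γ v e = 1) (a : G v) :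
    GraphProduct.tail Γ v (push v a e) = e := by
  unfold push
  split_ifs
  exacts [he.tail_eq_self h, tail_cons_self Γ v a e]

theorem IsIrreducible.push {v : V} (he : IsIrreducible Γ e) (h : head Γ v e = 1) (a : G v) :
    IsIrreducible Γ (push v a e) := by
  unfold GraphProduct.push
  split_ifs with ha
  exacts [he, ⟨ha, h, he⟩]

theorem IsIrreducible.shuffle_push_head_tail (he : IsIrreducible Γ e) (v : V) :
    Shuffle Γ (GraphProduct.push v (head Γ v e) (GraphProduct.tail Γ v e)) e := by
  by_cases h : head Γ v e = 1
  · rw [h, push_one, he.tail_eq_self h]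
    exact .refl e
  · rw [push_of_ne_one h]
    exact (shuffle_cons_head_tail h).symm

end Push

/-! ### The action on irreducible expressions and uniqueness of normal forms -/

section Action

variable {V : Type v} {Γ : SimpleGraph V} {G : V → Type w} [∀ i, Monoid (G i)]
  {e f : List (Σ i, G i)}

variable (Γ) in
/-- Left multiplication of an expression by `g ∈ G v`, in which `g` is merged with the front
`v`-syllable. -/
def act (v : V) (g : G v) (e : List (Σ i, G i)) : List (Σ i, G i) :=
  push v (g * head Γ v e) (tail Γ v e)

theorem IsIrreducible.act (he : IsIrreducible Γ e) (v : V) (g : G v) :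
    IsIrreducible Γ (act Γ v g e) :=
  (he.tail v).push (he.head_tail v) _

theorem Shuffle.act (h : Shuffle Γ e f) (v : V) (g : G v) :
    Shuffle Γ (act Γ v g e) (act Γ v g f) := by
  unfold GraphProduct.act
  rw [h.head_eq v]
  exact (h.tail v).push v _

theorem IsIrreducible.shuffle_act_one (he : IsIrreducible Γ e) (v : V) :
    Shuffle Γ (GraphProduct.act Γ v 1 e) e := by
  rw [GraphProduct.act, one_mul]
  exact he.shuffle_push_head_tail v

theorem IsIrreducible.act_mul (he : IsIrreducible Γ e) (v : V) (g h : G v) :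
    GraphProduct.act Γ v (g * h) e = GraphProduct.act Γ v g (GraphProduct.act Γ v h e) := by
  unfold GraphProduct.act
  rw [head_push (he.head_tail v), (he.tail v).tail_push (he.head_tail v), mul_assoc]

theorem shuffle_act_comm {u v : V} (h : Γ.Adj u v) (g : G u) (k : G v) (e : List (Σ i, G i)) :
    Shuffle Γ (act Γ u g (act Γ v k e)) (act Γ v k (act Γ u g e)) := by
  unfold act
  rw [head_push_of_adj h.symm, head_push_of_adj h, tail_push_of_adj h.symm, tail_push_of_adj h,
    head_tail_of_adj h, head_tail_of_adj h.symm, tail_comm_of_adj h]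
  exact shuffle_push_comm h _ _ _

variable (Γ G)

/-- Irreducible expressions are equivalent if they are shuffles of each other. -/
def shuffleSetoid : Setoid {e : List (Σ i, G i) // IsIrreducible Γ e} where
  r e f := Shuffle Γ e.1 f.1
  iseqv := ⟨fun e => .refl e.1, .symm, .trans⟩

/-- The irreducible expressions up to shuffling, on which the graph product acts. -/
abbrev NormalForm : Type (max v w) := Quotient (shuffleSetoid Γ G)

variable {G}

/-- The action of a vertex group on irreducible expressions up to shuffling. -/
def vertexAct (v : V) : G v →* Function.End (NormalForm Γ G) where
  toFun g := Quotient.map (fun e => ⟨act Γ v g e.1, e.2.act v g⟩) fun _ _ h => h.act v g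
  map_one' := funext <| Quotient.ind fun e => Quotient.sound (e.2.shuffle_act_one v)
  map_mul' g h := funext <| Quotient.ind fun e =>
    congrArg (Quotient.mk (shuffleSetoid Γ G)) (Subtype.ext (e.2.act_mul v g h))

variable {Γ}

theorem commute_vertexAct {u v : V} (h : Γ.Adj u v) (a : G u) (b : G v) :
    Commute (vertexAct Γ u a) (vertexAct Γ v b) :=
  funext <| Quotient.ind fun e => Quotient.sound (shuffle_act_comm h a b e.1)

end Action

section NormalForm

variable {V : Type v} (Γ : SimpleGraph V) {G : V → Type w} [∀ i, Group (G i)]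
  {e f : List (Σ i, G i)}

@[simp] theorem eval_nil : eval Γ ([] : List (Σ i, G i)) = 1 := rfl

theorem eval_cons (y : Σ i, G i) (e : List (Σ i, G i)) :
    eval Γ (y :: e) = of Γ y.1 y.2 * eval Γ e := by
  simp [eval]

theorem eval_append (e f : List (Σ i, G i)) : eval Γ (e ++ f) = eval Γ e * eval Γ f := by
  simp [eval]

theorem eval_push (v : V) (a : G v) (e : List (Σ i, G i)) :
    eval Γ (push v a e) = of Γ v a * eval Γ e := by
  unfold push
  split_ifs with ha
  · rw [ha, map_one, one_mul]
  · exact eval_cons Γ _ e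

variable {Γ}

theorem commute_of {i j : V} (h : Γ.Adj i j) (a : G i) (b : G j) :
    Commute (of Γ i a) (of Γ j b) := by
  have hrel : QuotientGroup.mk' (Subgroup.normalClosure (graphRelators Γ G))
      (.of a * .of b * (.of a)⁻¹ * (.of b)⁻¹) = 1 :=
    (QuotientGroup.eq_one_iff _).2 (Subgroup.subset_normalClosure ⟨i, j, a, b, h, rfl⟩)
  simp only [map_mul, map_inv] at hrel
  exact mul_inv_eq_iff_eq_mul.1 (mul_inv_eq_one.1 hrel)

theorem Shuffle.eval_eq (h : Shuffle Γ e f) : eval Γ e = eval Γ f := by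
  induction h with
  | nil => rfl
  | cons y _ ih => rw [eval_cons, eval_cons, ih]
  | @swap y z e h =>
    simp only [eval_cons, ← mul_assoc]
    rw [(commute_of h y.2 z.2).eq]
  | trans _ _ h₁ h₂ => exact h₁.trans h₂

theorem eval_head_tail (v : V) (e : List (Σ i, G i)) :
    of Γ v (head Γ v e) * eval Γ (tail Γ v e) = eval Γ e := by
  induction e using front_induction Γ v with
  | nil => simp
  | self a e => rw [tail_cons_self, head_cons_self, eval_cons]
  | adj y e hy ih =>
    rw [tail_cons_adj hy, head_cons_adj hy, eval_cons, eval_cons, ← mul_assoc,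
      (commute_of hy.symm _ _).eq, mul_assoc, ih]
  | blocked y e hv hadj =>
    rw [tail_cons_blocked hv hadj, head_cons_blocked hv hadj, map_one, one_mul]

theorem eval_act (v : V) (g : G v) (e : List (Σ i, G i)) :
    eval Γ (act Γ v g e) = of Γ v g * eval Γ e := by
  rw [act, eval_push, map_mul, mul_assoc, eval_head_tail]

variable (Γ) in
/-- The action of the graph product on irreducible expressions up to shuffling. -/
def actHom : GraphProduct Γ G →* Function.End (NormalForm Γ G) :=
  QuotientGroup.lift _ (Monoid.CoprodI.lift (vertexAct Γ)) fun x hx => by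
    refine Subgroup.normalClosure_le_normal
      (N := (Monoid.CoprodI.lift (vertexAct Γ)).ker) ?_ hx
    rintro _ ⟨i, j, a, b, h, rfl⟩
    rw [SetLike.mem_coe, MonoidHom.mem_ker]
    simp only [← map_inv, map_mul, Monoid.CoprodI.lift_of]
    rw [(commute_vertexAct h a b).eq, mul_assoc (vertexAct Γ j b), ← map_mul, mul_inv_cancel,
      map_one, mul_one, ← map_mul, mul_inv_cancel, map_one]

theorem actHom_of (v : V) (g : G v) : actHom Γ (of Γ v g) = vertexAct Γ v g :=
  Monoid.CoprodI.lift_of (fi := vertexAct Γ) g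

theorem actHom_eval (he : IsIrreducible Γ e) :
    actHom Γ (eval Γ e) (Quotient.mk _ ⟨[], trivial⟩) = Quotient.mk _ ⟨e, he⟩ := by
  induction e with
  | nil => rw [eval_nil, map_one, Function.End.one_def, id]
  | cons y e ih =>
    have hact : act Γ y.1 y.2 e = y :: e := by
      rw [act, he.2.1, mul_one, he.2.2.tail_eq_self he.2.1, push_of_ne_one he.1]
    calc actHom Γ (eval Γ (y :: e)) (Quotient.mk _ ⟨[], trivial⟩)
        = vertexAct Γ y.1 y.2 (actHom Γ (eval Γ e) (Quotient.mk _ ⟨[], trivial⟩)) := by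
          rw [eval_cons, map_mul, actHom_of]; rfl
      _ = vertexAct Γ y.1 y.2 (Quotient.mk _ ⟨e, he.2.2⟩) := congrArg _ (ih he.2.2)
      _ = Quotient.mk _ ⟨y :: e, he⟩ :=
          congrArg (Quotient.mk (shuffleSetoid Γ G)) (Subtype.ext hact)

theorem IsIrreducible.shuffle_of_eval_eq (he : IsIrreducible Γ e) (hf : IsIrreducible Γ f)
    (h : eval Γ e = eval Γ f) : Shuffle Γ e f := by
  have heq := actHom_eval he
  rw [h, actHom_eval hf] at heq
  exact (Quotient.exact heq).symm

theorem eval_surjective : Function.Surjective (eval Γ : List (Σ i, G i) → GraphProduct Γ G) := by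
  intro g
  obtain ⟨x, rfl⟩ := QuotientGroup.mk_surjective g
  induction x using Monoid.CoprodI.induction_on with
  | one => exact ⟨[], rfl⟩
  | of i a => exact ⟨[⟨i, a⟩], by rw [eval_cons, eval_nil, mul_one]; rfl⟩
  | mul x y hx hy =>
    obtain ⟨e, he⟩ := hx
    obtain ⟨f, hf⟩ := hy
    exact ⟨e ++ f, by rw [eval_append, he, hf]; rfl⟩

variable (Γ) in
/-- The irreducible expression obtained by multiplying up the syllables from the right. -/
def normalize (e : List (Σ i, G i)) : List (Σ i, G i) :=
  e.foldr (fun y f => act Γ y.1 y.2 f) []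

theorem isIrreducible_normalize (e : List (Σ i, G i)) : IsIrreducible Γ (normalize Γ e) := by
  induction e with
  | nil => trivial
  | cons y e ih => exact ih.act y.1 y.2

theorem eval_normalize (e : List (Σ i, G i)) : eval Γ (normalize Γ e) = eval Γ e := by
  induction e with
  | nil => rfl
  | cons y e ih =>
    rw [eval_cons, ← ih]
    exact eval_act _ _ _

theorem exists_isIrreducible (g : GraphProduct Γ G) : ∃ e, IsIrreducible Γ e ∧ eval Γ e = g := by
  obtain ⟨e, rfl⟩ := eval_surjective g
  exact ⟨_, isIrreducible_normalize e, eval_normalize e⟩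

theorem exists_shorter (he : ¬ IsIrreducible Γ e) :
    ∃ f, eval Γ f = eval Γ e ∧ f.length < e.length := by
  induction e with
  | nil => exact absurd trivial he
  | cons y e ih =>
    by_cases hirred : IsIrreducible Γ e
    · by_cases hy : y.2 = 1
      · exact ⟨e, by rw [eval_cons, hy, map_one, one_mul], by simp⟩
      have hhead : head Γ y.1 e ≠ 1 := fun h => he ⟨hy, h, hirred⟩
      have hlength := (shuffle_cons_head_tail hhead).perm.length_eq
      refine ⟨act Γ y.1 y.2 e, by rw [eval_act, eval_cons], ?_⟩
      unfold act push
      split_ifs <;> simp_all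
    · obtain ⟨f, hf, hlt⟩ := ih hirred
      exact ⟨y :: f, by rw [eval_cons, eval_cons, hf], by simpa using hlt⟩

theorem IsReduced.isIrreducible (he : IsReduced Γ e) : IsIrreducible Γ e := by
  by_contra h
  obtain ⟨f, hf, hlt⟩ := exists_shorter h
  exact (he f hf).not_gt hlt

end NormalForm

/-! ### Cancellation in a product of two irreducible expressions -/

section Syllables

variable {V : Type v} {Γ : SimpleGraph V} {G : V → Type w} {Λ : List V}

/-- The expression `s_{v₁} ⋯ s_{v_k}` for a list `v₁, …, v_k` of vertices. -/
def syllables (Λ : List V) (s : ∀ i, G i) : List (Σ i, G i) :=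
  Λ.map fun v => ⟨v, s v⟩

theorem map_fst_syllables (Λ : List V) (s : ∀ i, G i) : (syllables Λ s).map Sigma.fst = Λ := by
  simp [syllables, Function.comp_def]

theorem syllables_cons (v : V) (Λ : List V) (s : ∀ i, G i) :
    syllables (v :: Λ) s = ⟨v, s v⟩ :: syllables Λ s := rfl

open Classical in
theorem syllables_cons_update {v : V} (hv : v ∉ Λ) (s : ∀ i, G i) (a : G v) :
    syllables (v :: Λ) (Function.update s v a) = ⟨v, a⟩ :: syllables Λ s := by
  have htail : syllables Λ (Function.update s v a) = syllables Λ s :=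
    List.map_congr_left fun u hu => by
      rw [Function.update_of_ne (ne_of_mem_of_not_mem hu hv)]
  rw [syllables_cons, Function.update_self, htail]

theorem adj_of_mem_syllables {v : V} (h : ∀ u ∈ Λ, Γ.Adj u v) (s : ∀ i, G i) :
    ∀ y ∈ syllables Λ s, Γ.Adj y.1 v :=
  List.forall_mem_map.2 h

theorem eq_of_shuffle_syllables {s t : ∀ i, G i} (h : Shuffle Γ (syllables Λ s) (syllables Λ t))
    {v : V} (hv : v ∈ Λ) : s v = t v := by
  have hmem : (⟨v, s v⟩ : Σ i, G i) ∈ syllables Λ t := h.perm.subset (List.mem_map_of_mem hv)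
  obtain ⟨u, -, hu⟩ := List.mem_map.1 hmem
  obtain ⟨rfl, hu⟩ := Sigma.mk.inj_iff.1 hu
  exact (eq_of_heq hu).symm

variable [∀ i, One (G i)]

theorem head_syllables_of_mem {v : V} (hΛ : Λ.Pairwise Γ.Adj) (hv : v ∈ Λ) (s : ∀ i, G i)
    (e : List (Σ i, G i)) : head Γ v (syllables Λ s ++ e) = s v := by
  induction Λ with
  | nil => simp at hv
  | cons u Λ ih =>
    obtain ⟨hu, hΛ⟩ := List.pairwise_cons.1 hΛ
    rw [syllables_cons, List.cons_append]
    rcases eq_or_ne v u with rfl | hvu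
    · exact head_cons_self Γ v _ _
    · have hvΛ := List.mem_of_ne_of_mem hvu hv
      rw [head_cons_adj (hu v hvΛ), ih hΛ hvΛ]

theorem head_syllables_of_notMem {v : V} (hv : v ∉ Λ) (h : ¬ ∀ u ∈ Λ, Γ.Adj u v)
    (s : ∀ i, G i) (e : List (Σ i, G i)) : head Γ v (syllables Λ s ++ e) = 1 := by
  induction Λ with
  | nil => simp at h
  | cons u Λ ih =>
    rw [List.mem_cons, not_or] at hv
    rw [syllables_cons, List.cons_append]
    by_cases hu : Γ.Adj u v
    · rw [head_cons_adj hu, ih hv.2 fun h' => h (List.forall_mem_cons.2 ⟨hu, h'⟩)]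
    · exact head_cons_blocked (Ne.symm hv.1) hu _

end Syllables

section Cancellation

variable {V : Type v} {Γ : SimpleGraph V} {G : V → Type w} [∀ i, Group (G i)]

theorem eval_syllables_mul {Λ : List V} (hΛ : Λ.Pairwise Γ.Adj) (s t : ∀ i, G i) :
    eval Γ (syllables Λ (s * t)) = eval Γ (syllables Λ s) * eval Γ (syllables Λ t) := by
  induction Λ with
  | nil => simp [syllables]
  | cons v Λ ih =>
    obtain ⟨hv, hΛ⟩ := List.pairwise_cons.1 hΛ
    have hcomm : of Γ v (t v) * eval Γ (syllables Λ s) =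
        eval Γ (syllables Λ s) * of Γ v (t v) := by
      have hshuffle : Shuffle Γ (⟨v, t v⟩ :: (syllables Λ s ++ [])) (syllables Λ s ++ [⟨v, t v⟩]) :=
        .cons_append (adj_of_mem_syllables (fun u hu => (hv u hu).symm) s) []
      simpa [eval_cons, eval_append] using hshuffle.eval_eq
    simp only [syllables_cons, eval_cons, Pi.mul_apply, map_mul, ih hΛ, mul_assoc]
    rw [← mul_assoc (of Γ v (t v)), hcomm, mul_assoc]

/-- The expression of the inverse of an element, given an expression of the element. -/
def inverse (e : List (Σ i, G i)) : List (Σ i, G i) :=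
  (e.map fun y => ⟨y.1, y.2⁻¹⟩).reverse

theorem inverse_cons (y : Σ i, G i) (e : List (Σ i, G i)) :
    inverse (y :: e) = inverse e ++ [⟨y.1, y.2⁻¹⟩] := by simp [inverse]

theorem length_inverse (e : List (Σ i, G i)) : (inverse e).length = e.length := by
  simp [inverse]

theorem eval_inverse (e : List (Σ i, G i)) : eval Γ (inverse e) = (eval Γ e)⁻¹ := by
  induction e with
  | nil => exact inv_one.symm
  | cons y e ih =>
    rw [inverse_cons, eval_append, ih, eval_cons, eval_cons, eval_nil, mul_inv_rev, map_inv,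
      mul_one]

variable (Γ) in
/-- The cancellation in the product of two irreducible expressions `e` and `f`: after shuffling,
`e = p s q` and `f = q⁻¹ t r` with `s` and `t` in the product of the vertex groups of a clique,
such that `p (s t) r` is irreducible. -/
structure Cancellation (e f : List (Σ i, G i)) where
  /-- The expression `p`, which survives in the product. -/
  left : List (Σ i, G i)
  /-- The expression `q`, which cancels. -/
  cancelled : List (Σ i, G i)
  /-- The expression `r`, which survives in the product. -/
  right : List (Σ i, G i)
  /-- The vertices of the clique. -/
  clique : List V
  /-- The part `s` of `e` that merges with `t`. -/
  fst : ∀ i, G i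
  /-- The part `t` of `f` that merges with `s`. -/
  snd : ∀ i, G i
  pairwise_clique : clique.Pairwise Γ.Adj
  fst_eq_one : ∀ v ∉ clique, fst v = 1
  snd_eq_one : ∀ v ∉ clique, snd v = 1
  shuffle_left : Shuffle Γ e (left ++ (syllables clique fst ++ cancelled))
  shuffle_right : Shuffle Γ f (inverse cancelled ++ (syllables clique snd ++ right))
  isIrreducible : IsIrreducible Γ (left ++ (syllables clique (fst * snd) ++ right))

namespace Cancellation

variable {e f : List (Σ i, G i)} {y : Σ i, G i}

/-- The cancellation of a trivial product, with all of `f` surviving. -/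
def nil (hf : IsIrreducible Γ f) : Cancellation Γ [] f where
  left := []
  cancelled := []
  right := f
  clique := []
  fst := 1
  snd := 1
  pairwise_clique := .nil
  fst_eq_one _ _ := rfl
  snd_eq_one _ _ := rfl
  shuffle_left := .nil
  shuffle_right := .refl f
  isIrreducible := hf

variable (c : Cancellation Γ e f)

/-- The product expression `p (s t) r`. -/
def product : List (Σ i, G i) :=
  c.left ++ (syllables c.clique (c.fst * c.snd) ++ c.right)

/-- A syllable that meets nothing to merge with survives. -/
def consLeft (hy : y.2 ≠ 1) (hhead : head Γ y.1 c.product = 1) : Cancellation Γ (y :: e) f where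
  __ := c
  left := y :: c.left
  shuffle_left := c.shuffle_left.cons y
  isIrreducible := ⟨hy, hhead, c.isIrreducible⟩

/-- A syllable that merges with the product commutes with `p` and `s`, since it does not merge
with `e`. -/
theorem adj_of_head_ne_one (hye : IsIrreducible Γ (y :: e)) (hhead : head Γ y.1 c.product ≠ 1) :
    (∀ z ∈ c.left, Γ.Adj z.1 y.1) ∧ (∀ u ∈ c.clique, Γ.Adj u y.1) := by
  have hirred := (c.shuffle_left.cons y).isIrreducible hye
  have hhead_e := hirred.2.1
  have hleft : ∀ z ∈ c.left, Γ.Adj z.1 y.1 := by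
    by_contra h
    rw [product, head_append_of_not_adj h] at hhead
    rw [head_append_of_not_adj h] at hhead_e
    exact hhead hhead_e
  refine ⟨hleft, ?_⟩
  rw [product, head_append_of_adj hleft] at hhead
  rw [head_append_of_adj hleft] at hhead_e
  by_contra h
  by_cases hy : y.1 ∈ c.clique
  · rw [head_syllables_of_mem c.pairwise_clique hy] at hhead_e
    have hmem : (⟨y.1, c.fst y.1⟩ : Σ i, G i) ∈ syllables c.clique c.fst :=
      List.mem_map_of_mem hy
    exact hirred.2.2.ne_one _ (List.mem_append_right _ (List.mem_append_left _ hmem)) hhead_e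
  · exact hhead (head_syllables_of_notMem hy h _ _)

variable {v : V} (hleft : ∀ z ∈ c.left, Γ.Adj z.1 v) (hclique : ∀ u ∈ c.clique, Γ.Adj u v)
  (hright : head Γ v c.right ≠ 1)

include hclique hright

theorem shuffle_head_right (p : List (Σ i, G i)) (s : ∀ i, G i) :
    Shuffle Γ (p ++ (syllables c.clique s ++ c.right))
      (p ++ ⟨v, head Γ v c.right⟩ :: (syllables c.clique s ++ tail Γ v c.right)) :=
  (((shuffle_cons_head_tail hright).append_left _).trans
    (Shuffle.cons_append (adj_of_mem_syllables hclique s) _).symm).append_left p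

theorem isIrreducible_head_right : IsIrreducible Γ (c.left ++ ⟨v, head Γ v c.right⟩ ::
    (syllables c.clique (c.fst * c.snd) ++ tail Γ v c.right)) :=
  (c.shuffle_head_right hclique hright _ _).isIrreducible c.isIrreducible

include hleft

/-- A syllable that meets its inverse at the front of `r` cancels. -/
def consCancelled {a : G v} (ha : a * head Γ v c.right = 1) : Cancellation Γ (⟨v, a⟩ :: e) f where
  __ := c
  cancelled := ⟨v, a⟩ :: c.cancelled
  right := tail Γ v c.right
  shuffle_left := (c.shuffle_left.cons _).trans <| (Shuffle.cons_append hleft _).trans <|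
    (Shuffle.cons_append (adj_of_mem_syllables hclique c.fst) _).append_left _
  shuffle_right := by
    rw [inverse_cons, List.append_assoc, ← eq_inv_of_mul_eq_one_right ha]
    exact c.shuffle_right.trans (c.shuffle_head_right hclique hright _ _)
  isIrreducible := (c.isIrreducible_head_right hclique hright).erase hleft

open Classical in
/-- A syllable that merges with the front of `r` without cancelling enlarges the clique. -/
def consClique {a : G v} (ha : a * head Γ v c.right ≠ 1) : Cancellation Γ (⟨v, a⟩ :: e) f :=
  have hv : v ∉ c.clique := fun h => Γ.irrefl (hclique v h)
  { left := c.left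
    cancelled := c.cancelled
    right := tail Γ v c.right
    clique := v :: c.clique
    fst := Function.update c.fst v a
    snd := Function.update c.snd v (head Γ v c.right)
    pairwise_clique := .cons (fun u hu => (hclique u hu).symm) c.pairwise_clique
    fst_eq_one u hu := by
      obtain ⟨huv, hu⟩ := not_or.1 (mt List.mem_cons.2 hu)
      rw [Function.update_of_ne huv, c.fst_eq_one u hu]
    snd_eq_one u hu := by
      obtain ⟨huv, hu⟩ := not_or.1 (mt List.mem_cons.2 hu)
      rw [Function.update_of_ne huv, c.snd_eq_one u hu]
    shuffle_left := by
      rw [syllables_cons_update hv]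
      exact (c.shuffle_left.cons _).trans (.cons_append hleft _)
    shuffle_right := by
      rw [syllables_cons_update hv]
      exact c.shuffle_right.trans (c.shuffle_head_right hclique hright _ _)
    isIrreducible := by
      rw [← Function.update_mul, syllables_cons_update hv]
      exact (c.isIrreducible_head_right hclique hright).replace ha }

end Cancellation

theorem nonempty_cancellation {e f : List (Σ i, G i)} (he : IsIrreducible Γ e)
    (hf : IsIrreducible Γ f) : Nonempty (Cancellation Γ e f) := by
  induction e with
  | nil => exact ⟨.nil hf⟩
  | cons y e ih =>
    obtain ⟨c⟩ := ih he.2.2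
    by_cases hhead : head Γ y.1 c.product = 1
    · exact ⟨c.consLeft he.1 hhead⟩
    obtain ⟨hleft, hclique⟩ := c.adj_of_head_ne_one he hhead
    rw [Cancellation.product, head_append_of_adj hleft,
      head_append_of_adj (adj_of_mem_syllables hclique _)] at hhead
    by_cases hy : y.2 * head Γ y.1 c.right = 1
    exacts [⟨c.consCancelled hleft hclique hhead hy⟩, ⟨c.consClique hleft hclique hhead hy⟩]

end Cancellation

section Splitting

variable {V : Type v} {G : V → Type w}

open Classical in
/-- The number of syllables of an expression in a given vertex group. -/
def syllableCount (e : List (Σ i, G i)) (v : V) : ℕ := (e.map Sigma.fst).count v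

theorem syllableCount_le (e : List (Σ i, G i)) (v : V) : syllableCount e v ≤ e.length := by
  classical
  exact List.count_le_length.trans (List.length_map Sigma.fst).le

theorem perm_of_syllableCount_eq {e f : List (Σ i, G i)} (h : syllableCount e = syllableCount f) :
    (e.map Sigma.fst).Perm (f.map Sigma.fst) := by
  classical
  exact List.perm_iff_count.2 fun v => by simpa only [syllableCount] using congrFun h v

variable (Γ : SimpleGraph V) [∀ i, Group (G i)]

/-- The product `a s b` in the graph product, where `s` stands for `s_{v₁} ⋯ s_{v_k}` with
`Λ = v₁, …, v_k`. -/
def glue (Λ : List V) (q : (GraphProduct Γ G × GraphProduct Γ G) × ∀ i, G i) : GraphProduct Γ G :=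
  q.1.1 * (eval Γ (syllables Λ q.2) * q.1.2)

/-- The triples `((a, b), s)` such that `a s b` is an irreducible product in which `a` has `m v`
syllables in each `G v` and `s` is in the product of the vertex groups of `Λ`. -/
def splittings (Λ : List V) (m : V → ℕ) :
    Set ((GraphProduct Γ G × GraphProduct Γ G) × ∀ i, G i) :=
  {q | ∃ p r, eval Γ p = q.1.1 ∧ eval Γ r = q.1.2 ∧ syllableCount p = m ∧
    (∀ v ∉ Λ, q.2 v = 1) ∧ IsIrreducible Γ (p ++ (syllables Λ q.2 ++ r))}

theorem injOn_glue (Λ : List V) (m : V → ℕ) :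
    Set.InjOn (glue Γ Λ) (splittings Γ Λ m (G := G)) := by
  rintro ⟨⟨a, b⟩, s⟩ ⟨p, r, rfl, rfl, hm, hs, hirred⟩ ⟨⟨a', b'⟩, s'⟩
    ⟨p', r', rfl, rfl, hm', hs', hirred'⟩ heq
  have hshuffle := hirred.shuffle_of_eval_eq hirred' (by simpa only [eval_append, glue] using heq)
  obtain ⟨hp, hsr⟩ := hshuffle.of_append (perm_of_syllableCount_eq (hm.trans hm'.symm))
  obtain ⟨hss', hr⟩ := hsr.of_append (by rw [map_fst_syllables, map_fst_syllables])
  have hs_eq : s = s' := funext fun v => by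
    by_cases hv : v ∈ Λ
    exacts [eq_of_shuffle_syllables hss' hv, (hs v hv).trans (hs' v hv).symm]
  rw [hp.eval_eq, hr.eval_eq, hs_eq]

variable {Γ}

theorem exists_splitting (g h : GraphProduct Γ G) {e : List (Σ i, G i)}
    (he : IsIrreducible Γ e) (heg : eval Γ e = g) :
    ∃ (m n : V → ℕ) (Λ : List V) (a c b : GraphProduct Γ G) (s t : ∀ i, G i),
      (∀ v, m v ≤ e.length) ∧ (∀ v, n v ≤ e.length) ∧ Λ.Pairwise Γ.Adj ∧
      (((a, c), s) ∈ splittings Γ Λ m ∧ glue Γ Λ ((a, c), s) = g) ∧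
      (((c⁻¹, b), t) ∈ splittings Γ Λ n ∧ glue Γ Λ ((c⁻¹, b), t) = h) ∧
      ((a, b), s * t) ∈ splittings Γ Λ m ∧ glue Γ Λ ((a, b), s * t) = g * h := by
  obtain ⟨f, hf, rfl⟩ := exists_isIrreducible h
  subst heg
  obtain ⟨⟨p, q, r, Λ, s, t, hΛ, hs, ht, hleft, hright, hirred⟩⟩ := nonempty_cancellation he hf
  have hlength := hleft.perm.length_eq
  simp only [List.length_append] at hlength
  have hg : glue Γ Λ ((eval Γ p, eval Γ q), s) = eval Γ e := by
    rw [hleft.eval_eq, eval_append, eval_append]; rfl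
  have hh : glue Γ Λ (((eval Γ q)⁻¹, eval Γ r), t) = eval Γ f := by
    rw [hright.eval_eq, eval_append, eval_append, eval_inverse]; rfl
  refine ⟨syllableCount p, syllableCount (inverse q), Λ, eval Γ p, eval Γ q, eval Γ r, s, t,
    fun v => (syllableCount_le p v).trans (by lia), fun v => (syllableCount_le _ v).trans ?_, hΛ,
    ⟨⟨p, q, rfl, rfl, rfl, hs, hleft.isIrreducible he⟩, hg⟩,
    ⟨⟨inverse q, r, eval_inverse q, rfl, rfl, ht, hright.isIrreducible hf⟩, hh⟩,
    ⟨p, r, rfl, rfl, rfl, fun v hv => by simp [hs v hv, ht v hv], hirred⟩, ?_⟩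
  · rw [length_inverse]
    lia
  · rw [← hg, ← hh]
    simp only [glue, eval_syllables_mul hΛ]
    group

end Splitting

/-! ### The length function -/

section Length

variable {V : Type v} {Γ : SimpleGraph V} {G : V → Type w} [∀ i, Group (G i)]
  (l : ∀ i, GroupSeminorm (G i)) {e f : List (Σ i, G i)}

/-- The sum of the lengths of the syllables of an expression. -/
def weight (e : List (Σ i, G i)) : ℝ := (e.map fun y => l y.1 y.2).sum

@[simp] theorem weight_nil : weight l [] = 0 := rfl

@[simp] theorem weight_cons (y : Σ i, G i) (e : List (Σ i, G i)) :
    weight l (y :: e) = l y.1 y.2 + weight l e := by simp [weight]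

theorem weight_append (e f : List (Σ i, G i)) : weight l (e ++ f) = weight l e + weight l f := by
  simp [weight]

theorem weight_inverse (e : List (Σ i, G i)) : weight l (inverse e) = weight l e := by
  simp [weight, inverse, Function.comp_def]

theorem weight_push (v : V) (a : G v) (e : List (Σ i, G i)) :
    weight l (push v a e) = l v a + weight l e := by
  unfold push
  split_ifs with ha
  · rw [ha, map_one_eq_zero, zero_add]
  · exact weight_cons l _ e

theorem Shuffle.weight_eq (h : Shuffle Γ e f) : weight l e = weight l f :=
  (h.perm.map _).sum_eq

theorem weight_nonneg (e : List (Σ i, G i)) : 0 ≤ weight l e :=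
  List.sum_nonneg <| List.forall_mem_map.2 fun y _ => apply_nonneg (l y.1) y.2

theorem le_weight {y : Σ i, G i} (hy : y ∈ e) : l y.1 y.2 ≤ weight l e :=
  List.single_le_sum (List.forall_mem_map.2 fun z _ => apply_nonneg (l z.1) z.2) _
    (List.mem_map_of_mem hy)

theorem weight_head_tail (v : V) (e : List (Σ i, G i)) :
    l v (head Γ v e) + weight l (tail Γ v e) = weight l e := by
  induction e using front_induction Γ v with
  | nil => simp
  | self a e => simp
  | adj y e hy ih =>
    rw [tail_cons_adj hy, head_cons_adj hy, weight_cons, weight_cons, ← ih, add_left_comm]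
  | blocked y e hv hadj =>
    rw [tail_cons_blocked hv hadj, head_cons_blocked hv hadj, map_one_eq_zero, zero_add]

theorem weight_act_le (v : V) (g : G v) (e : List (Σ i, G i)) :
    weight l (act Γ v g e) ≤ l v g + weight l e := by
  rw [act, weight_push, ← weight_head_tail (Γ := Γ) l v e, ← add_assoc]
  gcongr
  exact map_mul_le_add (l v) g _

theorem weight_normalize_le (e : List (Σ i, G i)) : weight l (normalize Γ e) ≤ weight l e := by
  induction e with
  | nil => rfl
  | cons y e ih =>
    rw [weight_cons]
    exact (weight_act_le l y.1 y.2 (normalize Γ e)).trans (by gcongr)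

theorem IsIrreducible.weight_le (he : IsIrreducible Γ e) (h : eval Γ f = eval Γ e) :
    weight l e ≤ weight l f := by
  have hshuffle := he.shuffle_of_eval_eq (isIrreducible_normalize f)
    (h.symm.trans (eval_normalize f).symm)
  exact (hshuffle.weight_eq l).trans_le (weight_normalize_le l f)

/-- A chosen irreducible expression of an element of the graph product. -/
def irreducibleExpr (g : GraphProduct Γ G) : List (Σ i, G i) := (exists_isIrreducible g).choose

theorem isIrreducible_irreducibleExpr (g : GraphProduct Γ G) :
    IsIrreducible Γ (irreducibleExpr g) := (exists_isIrreducible g).choose_spec.1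

theorem eval_irreducibleExpr (g : GraphProduct Γ G) : eval Γ (irreducibleExpr g) = g :=
  (exists_isIrreducible g).choose_spec.2

theorem weight_irreducibleExpr_le {g : GraphProduct Γ G} (h : eval Γ e = g) :
    weight l (irreducibleExpr g) ≤ weight l e :=
  (isIrreducible_irreducibleExpr g).weight_le l (h.trans (eval_irreducibleExpr g).symm)

theorem weight_irreducibleExpr_inv_le (g : GraphProduct Γ G) :
    weight l (irreducibleExpr g⁻¹) ≤ weight l (irreducibleExpr g) := by
  rw [← weight_inverse l (irreducibleExpr g)]
  exact weight_irreducibleExpr_le l (by rw [eval_inverse, eval_irreducibleExpr])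

variable (Γ) in
/-- The length function `l_G` on the graph product that sums the lengths of the syllables of an
irreducible expression. -/
def length : GroupSeminorm (GraphProduct Γ G) where
  toFun g := weight l (irreducibleExpr g)
  map_one' := (weight_irreducibleExpr_le l (eval_nil Γ)).antisymm (weight_nonneg l _)
  mul_le' g h := by
    rw [← weight_append]
    exact weight_irreducibleExpr_le l
      (by rw [eval_append, eval_irreducibleExpr, eval_irreducibleExpr])
  inv' g := (weight_irreducibleExpr_inv_le l g).antisymm <| by
    simpa only [inv_inv] using weight_irreducibleExpr_inv_le l g⁻¹

theorem IsIrreducible.length_eval (he : IsIrreducible Γ e) :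
    length Γ l (eval Γ e) = weight l e :=
  ((isIrreducible_irreducibleExpr _).shuffle_of_eval_eq he (eval_irreducibleExpr _)).weight_eq l

theorem le_length_glue {Λ : List V} {m : V → ℕ}
    {q : (GraphProduct Γ G × GraphProduct Γ G) × ∀ i, G i} (hq : q ∈ splittings Γ Λ m) (v : V) :
    l v (q.2 v) ≤ length Γ l (glue Γ Λ q) := by
  obtain ⟨⟨a, b⟩, s⟩ := q
  obtain ⟨p, r, rfl, rfl, -, hs, hirred⟩ := hq
  by_cases hv : v ∈ Λ
  · have hmem : (⟨v, s v⟩ : Σ i, G i) ∈ p ++ (syllables Λ s ++ r) :=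
      List.mem_append_right _ (List.mem_append_left _ (List.mem_map_of_mem hv))
    rw [glue, ← eval_append, ← eval_append, hirred.length_eval l]
    exact le_weight l hmem
  · rw [hs v hv, map_one_eq_zero]
    exact apply_nonneg _ _

variable {l}

theorem IsIrreducible.length_le_mul_weight (he : IsIrreducible Γ e) {M : ℝ}
    (hM : ∀ i, ∀ g : G i, g ≠ 1 → 1 ≤ M * l i g) : e.length ≤ M * weight l e := by
  induction e with
  | nil => simp
  | cons y e ih =>
    rw [List.length_cons, weight_cons, mul_add]
    push_cast
    linarith [ih he.2.2, hM y.1 y.2 he.1]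

end Length

end GraphProduct

/-! ### The `2`-norm of `ℝ≥0∞`-valued functions -/

section L2Norm

variable {α β γ : Type*}

/-- The `2`-norm of an `ℝ≥0∞`-valued function with respect to the counting measure. -/
def l2norm (f : α → ℝ≥0∞) : ℝ≥0∞ := (∑' a, f a ^ 2) ^ (1 / 2 : ℝ)

theorem l2norm_sq (f : α → ℝ≥0∞) : l2norm f ^ 2 = ∑' a, f a ^ 2 := by
  rw [l2norm, ← ENNReal.rpow_two, ← ENNReal.rpow_mul]
  norm_num

theorem l2norm_eq_of_sq {f : α → ℝ≥0∞} {a : ℝ≥0∞} (h : ∑' i, f i ^ 2 = a ^ 2) : l2norm f = a := by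
  rw [l2norm, h, ← ENNReal.rpow_two, ← ENNReal.rpow_mul]
  norm_num

theorem l2norm_le_l2norm {f : α → ℝ≥0∞} {g : β → ℝ≥0∞} (h : ∑' a, f a ^ 2 ≤ ∑' b, g b ^ 2) :
    l2norm f ≤ l2norm g :=
  ENNReal.rpow_le_rpow h (by norm_num)

theorem l2norm_eq_zero {f : α → ℝ≥0∞} : l2norm f = 0 ↔ f = 0 := by
  rw [← pow_eq_zero_iff two_ne_zero, l2norm_sq, ENNReal.tsum_eq_zero, funext_iff]
  simp only [pow_eq_zero_iff two_ne_zero, Pi.zero_apply]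

theorem apply_ne_top_of_l2norm_ne_top {f : α → ℝ≥0∞} (h : l2norm f ≠ ⊤) (a : α) : f a ≠ ⊤ := by
  have hsq : ∑' a, f a ^ 2 ≠ ⊤ := l2norm_sq f ▸ ENNReal.pow_ne_top h
  exact (ENNReal.pow_ne_top_iff.1 (ENNReal.ne_top_of_tsum_ne_top hsq a)).resolve_right two_ne_zero

theorem l2norm_unique [Unique α] (f : α → ℝ≥0∞) : l2norm f = f default :=
  l2norm_eq_of_sq (tsum_eq_single default fun a ha => absurd (Subsingleton.elim a _) ha)

theorem l2norm_comp_equiv (e : α ≃ β) (f : β → ℝ≥0∞) : l2norm (f ∘ e) = l2norm f :=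
  congrArg (· ^ (1 / 2 : ℝ)) (e.tsum_eq fun b => f b ^ 2)

theorem l2norm_indicator_comp_le {s : Set α} {φ : α → β} (hφ : s.InjOn φ) (f : β → ℝ≥0∞) :
    l2norm (s.indicator (f ∘ φ)) ≤ l2norm f := by
  refine l2norm_le_l2norm ?_
  calc ∑' a, s.indicator (f ∘ φ) a ^ 2
      = ∑' a : s, f (φ a) ^ 2 := by
        rw [tsum_subtype s fun a => f (φ a) ^ 2]
        exact tsum_congr fun a => by by_cases ha : a ∈ s <;> simp [ha]
    _ ≤ ∑' b, f b ^ 2 :=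
        ENNReal.tsum_comp_le_tsum_of_injective hφ.injective fun b => f b ^ 2

theorem l2norm_prod (f : α × β → ℝ≥0∞) :
    l2norm (fun a => l2norm fun b => f (a, b)) = l2norm f := by
  refine l2norm_eq_of_sq ?_
  simp only [l2norm_sq, ENNReal.tsum_prod']

theorem l2norm_mul (f : α → ℝ≥0∞) (g : β → ℝ≥0∞) :
    l2norm (fun p : α × β => f p.1 * g p.2) = l2norm f * l2norm g := by
  refine l2norm_eq_of_sq ?_
  rw [ENNReal.tsum_prod', mul_pow, l2norm_sq, l2norm_sq]
  simp only [mul_pow, ENNReal.tsum_mul_left, ENNReal.tsum_mul_right]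

theorem tsum_mul_le_l2norm_mul (f g : α → ℝ≥0∞) : ∑' a, f a * g a ≤ l2norm f * l2norm g := by
  let _ : MeasurableSpace α := ⊤
  simpa only [l2norm, MeasureTheory.lintegral_count, Pi.mul_apply, ENNReal.rpow_ofNat] using
    ENNReal.lintegral_mul_le_Lp_mul_Lq (μ := MeasureTheory.Measure.count)
      Real.HolderConjugate.two_two (f := f) (g := g) measurable_from_top.aemeasurable
      measurable_from_top.aemeasurable

theorem tsum_triangle_le (f : α × β → ℝ≥0∞) (g : β × γ → ℝ≥0∞) (h : α × γ → ℝ≥0∞) :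
    ∑' a, ∑' b, ∑' c, f (a, b) * g (b, c) * h (a, c) ≤ l2norm f * l2norm g * l2norm h := by
  calc ∑' a, ∑' b, ∑' c, f (a, b) * g (b, c) * h (a, c)
      = ∑' a, ∑' c, (∑' b, f (a, b) * g (b, c)) * h (a, c) := by
        refine tsum_congr fun a => ?_
        rw [ENNReal.tsum_comm]
        simp only [ENNReal.tsum_mul_right]
    _ ≤ ∑' a, ∑' c, ((l2norm fun b => f (a, b)) * l2norm fun b => g (b, c)) * h (a, c) := by
        gcongr
        exact tsum_mul_le_l2norm_mul _ _
    _ = ∑' p, ((l2norm fun b => f (p.1, b)) * l2norm fun b => g (b, p.2)) * h p := by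
        rw [ENNReal.tsum_prod']
    _ ≤ l2norm (fun p : α × γ => (l2norm fun b => f (p.1, b)) * l2norm fun b => g (b, p.2)) *
          l2norm h := tsum_mul_le_l2norm_mul _ _
    _ = l2norm f * l2norm g * l2norm h := by
        rw [l2norm_mul (fun a => l2norm fun b => f (a, b)) fun c => l2norm fun b => g (b, c),
          l2norm_prod, ← l2norm_comp_equiv (Equiv.prodComm γ β) g,
          ← l2norm_prod (g ∘ Equiv.prodComm γ β)]
        rfl

theorem tsum_le_tsum_of_forall_exists {f : α → ℝ≥0∞} {g : β → ℝ≥0∞} (φ : β → α)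
    (h : ∀ a, f a ≠ 0 → ∃ b, φ b = a ∧ f a ≤ g b) : ∑' a, f a ≤ ∑' b, g b := by
  rw [← ENNReal.tsum_fiberwise g φ]
  refine ENNReal.tsum_le_tsum fun a => ?_
  by_cases ha : f a = 0
  · rw [ha]
    exact zero_le
  · obtain ⟨b, hb, hle⟩ := h a ha
    exact hle.trans (ENNReal.le_tsum (f := fun b : φ ⁻¹' {a} => g b) ⟨b, hb⟩)

end L2Norm

/-! ### Convolution bounds -/

section ConvolutionBound

/-- `‖x * ξ‖₂ ≤ K ‖x‖₂ ‖ξ‖₂` for nonnegative functions `x` supported on `S` and `ξ`, written as an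
inequality of trilinear forms. -/
def ConvolutionBound {G : Type*} [Group G] (S : Set G) (K : ℝ≥0∞) : Prop :=
  ∀ x ξ η : G → ℝ≥0∞, (∀ g, x g ≠ 0 → g ∈ S) →
    ∑' g, ∑' h, x g * ξ h * η (g * h) ≤ K * l2norm x * l2norm ξ * l2norm η

variable {G H : Type*} [Group G] [Group H] {S : Set G} {S' : Set H} {K L : ℝ≥0∞}

theorem ConvolutionBound.preimage (hS : ConvolutionBound S K) (e : H ≃* G) :
    ConvolutionBound (e ⁻¹' S) K := by
  intro x ξ η hx
  have hnorm : ∀ f : H → ℝ≥0∞, l2norm (f ∘ e.symm) = l2norm f :=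
    l2norm_comp_equiv e.symm.toEquiv
  calc ∑' g, ∑' h, x g * ξ h * η (g * h)
      = ∑' g, ∑' h, (x ∘ e.symm) g * (ξ ∘ e.symm) h * (η ∘ e.symm) (g * h) := by
        simp only [Function.comp_apply, map_mul]
        rw [← e.symm.toEquiv.tsum_eq]
        exact tsum_congr fun g => (e.symm.toEquiv.tsum_eq _).symm
    _ ≤ K * l2norm (x ∘ e.symm) * l2norm (ξ ∘ e.symm) * l2norm (η ∘ e.symm) :=
        hS _ _ _ fun g hg => by simpa using hx _ hg
    _ = K * l2norm x * l2norm ξ * l2norm η := by rw [hnorm, hnorm, hnorm]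

theorem ConvolutionBound.prod (hS : ConvolutionBound S K) (hS' : ConvolutionBound S' L) :
    ConvolutionBound (S ×ˢ S') (K * L) := by
  intro x ξ η hx
  have hsupp : ∀ a, l2norm (fun b => x (a, b)) ≠ 0 → a ∈ S := by
    intro a ha
    obtain ⟨b, hb⟩ := Function.ne_iff.1 (mt l2norm_eq_zero.2 ha)
    exact (hx _ hb).1
  calc ∑' g, ∑' h, x g * ξ h * η (g * h)
      = ∑' a, ∑' a', ∑' b, ∑' b', x (a, b) * ξ (a', b') * η (a * a', b * b') := by
        rw [ENNReal.tsum_prod']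
        refine tsum_congr fun a => ?_
        simp only [ENNReal.tsum_prod']
        exact ENNReal.tsum_comm
    _ ≤ ∑' a, ∑' a', L * l2norm (fun b => x (a, b)) * l2norm (fun b => ξ (a', b)) *
          l2norm (fun b => η (a * a', b)) := by
        gcongr with a a'
        exact hS' _ _ _ fun b hb => (hx _ hb).2
    _ = L * ∑' a, ∑' a', l2norm (fun b => x (a, b)) * l2norm (fun b => ξ (a', b)) *
          l2norm (fun b => η (a * a', b)) := by
        simp only [mul_assoc, ENNReal.tsum_mul_left]
    _ ≤ L * (K * l2norm x * l2norm ξ * l2norm η) := by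
        gcongr
        simpa only [l2norm_prod] using hS (fun a => l2norm fun b => x (a, b))
          (fun a => l2norm fun b => ξ (a, b)) (fun a => l2norm fun b => η (a, b)) hsupp
    _ = K * L * l2norm x * l2norm ξ * l2norm η := by ring

theorem ConvolutionBound.of_unique [Unique G] : ConvolutionBound S 1 := by
  intro x ξ η _
  have htsum : ∀ f : G → ℝ≥0∞, ∑' g, f g = f default := fun f =>
    tsum_eq_single default fun g hg => absurd (Subsingleton.elim g _) hg
  rw [htsum, htsum, l2norm_unique, l2norm_unique, l2norm_unique, one_mul,
    Subsingleton.elim (default * default : G) default]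

end ConvolutionBound

section Pi

/-- The group isomorphism splitting off the `none` coordinate of a product indexed by
`Option α`. -/
def piOptionMulEquivProd {α : Type v} (G : Option α → Type w) [∀ i, Mul (G i)] :
    (∀ i, G i) ≃* G none × ∀ a, G (some a) :=
  { Equiv.piOptionEquivProd with map_mul' := fun _ _ => rfl }

/-- The group isomorphism reindexing a product of groups. -/
def piReindexMulEquiv {α β : Type v} (e : α ≃ β) (G : β → Type w) [∀ i, Mul (G i)] :
    (∀ b, G b) ≃* ∀ a, G (e a) :=
  { Equiv.piCongrLeft' G e.symm with map_mul' := fun _ _ => rfl }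

theorem ConvolutionBound.pi_option {α : Type v} [Fintype α] {G : Option α → Type w}
    [∀ i, Group (G i)] {S : ∀ i, Set (G i)} {K : Option α → ℝ≥0∞}
    (hnone : ConvolutionBound (S none) (K none))
    (hsome : ConvolutionBound (Set.univ.pi fun a => S (some a)) (∏ a, K (some a))) :
    ConvolutionBound (Set.univ.pi S) (∏ i, K i) := by
  rw [Fintype.prod_option]
  convert (hnone.prod hsome).preimage (piOptionMulEquivProd G) using 1
  ext s
  simp only [Set.mem_univ_pi]
  exact Option.forall.trans (and_congr_right fun _ => Set.mem_univ_pi.symm)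

theorem ConvolutionBound.pi_reindex {α β : Type v} [Fintype α] [Fintype β] (e : α ≃ β)
    {G : β → Type w} [∀ i, Group (G i)] {S : ∀ i, Set (G i)} {K : β → ℝ≥0∞}
    (h : ConvolutionBound (Set.univ.pi fun a => S (e a)) (∏ a, K (e a))) :
    ConvolutionBound (Set.univ.pi S) (∏ i, K i) := by
  rw [← e.prod_comp]
  convert h.preimage (piReindexMulEquiv e G) using 1
  ext s
  simp only [Set.mem_univ_pi]
  exact (e.forall_congr_right (q := fun b => s b ∈ S b)).symm.trans Set.mem_univ_pi.symm

theorem ConvolutionBound.pi {V : Type v} [Fintype V] {G : V → Type w} [∀ i, Group (G i)]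
    {S : ∀ i, Set (G i)} {K : V → ℝ≥0∞} (h : ∀ i, ConvolutionBound (S i) (K i)) :
    ConvolutionBound (Set.univ.pi S) (∏ i, K i) := by
  refine Fintype.induction_empty_option (P := fun V _ =>
    ∀ {G : V → Type w} [∀ i, Group (G i)] {S : ∀ i, Set (G i)} {K : V → ℝ≥0∞},
      (∀ i, ConvolutionBound (S i) (K i)) → ConvolutionBound (Set.univ.pi S) (∏ i, K i))
    ?reindex ?empty ?option V h
  case reindex =>
    intro α β _ e ih G _ S K h
    let _ := Fintype.ofEquiv β e.symm
    exact .pi_reindex e (ih fun a => h (e a))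
  case empty =>
    intro G _ S K _
    rw [Fintype.prod_empty]
    exact .of_unique
  case option =>
    intro α _ ih G _ S K h
    exact .pi_option (h none) (ih fun a => h (some a))

end Pi

/-! ### Convolution bounds and the left regular representation -/

section RegularRep

variable {G : Type u}

theorem enorm_eq_l2norm (ξ : L2 G) : ‖ξ‖ₑ = l2norm fun g => ‖ξ g‖ₑ := by
  refine (l2norm_eq_of_sq ?_).symm
  have hnorm := lp.norm_rpow_eq_tsum (p := 2) (by norm_num) ξ
  have hsummable := (lp.memℓp ξ).summable (by norm_num)
  simp only [ENNReal.toReal_ofNat, Real.rpow_ofNat] at hnorm hsummable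
  rw [← ofReal_norm, ← ENNReal.ofReal_pow (norm_nonneg _), hnorm,
    ENNReal.ofReal_tsum_of_nonneg (fun _ => by positivity) hsummable]
  exact tsum_congr fun g => by rw [ENNReal.ofReal_pow (norm_nonneg _), ofReal_norm]

theorem twoNorm_nonneg (x : MonoidAlgebra ℂ G) : 0 ≤ twoNorm x := Real.sqrt_nonneg _

theorem ofReal_twoNorm (x : MonoidAlgebra ℂ G) :
    ENNReal.ofReal (twoNorm x) = l2norm fun g => ‖x.coeff g‖ₑ := by
  refine (l2norm_eq_of_sq ?_).symm
  rw [← ENNReal.ofReal_pow (twoNorm_nonneg x), twoNorm,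
    Real.sq_sqrt (Finset.sum_nonneg fun _ _ => by positivity),
    ENNReal.ofReal_sum_of_nonneg fun _ _ => by positivity, tsum_eq_sum (s := x.coeff.support)]
  · exact Finset.sum_congr rfl fun g _ => by
      rw [ENNReal.ofReal_pow (norm_nonneg _), ofReal_norm]
  · intro g hg
    simp [Finsupp.notMem_support_iff.1 hg]

/-- The element of `ℂ[G]` with the given nonnegative real coefficients. -/
def complexify (x : G →₀ ℝ≥0) : MonoidAlgebra ℂ G :=
  .ofCoeff (x.mapRange (fun r : ℝ≥0 => ((r : ℝ) : ℂ)) Complex.ofReal_zero)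

theorem enorm_ofReal_coe (r : ℝ≥0) : ‖((r : ℝ) : ℂ)‖ₑ = r := by
  rw [← ofReal_norm, Complex.norm_real, Real.norm_of_nonneg r.coe_nonneg, ENNReal.ofReal_coe_nnreal]

theorem support_complexify (x : G →₀ ℝ≥0) : (complexify x).coeff.support = x.support :=
  Finsupp.support_mapRange_of_injective (e := fun r : ℝ≥0 => ((r : ℝ) : ℂ)) Complex.ofReal_zero x
    fun _ _ h => NNReal.coe_injective (Complex.ofReal_injective h)

theorem ofReal_twoNorm_complexify (x : G →₀ ℝ≥0) :
    ENNReal.ofReal (twoNorm (complexify x)) = l2norm fun g => (x g : ℝ≥0∞) := by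
  rw [ofReal_twoNorm]
  exact congrArg l2norm (funext fun g => enorm_ofReal_coe (x g))

theorem memLp_of_l2norm_ne_top {ξ : G → ℝ≥0} (hξ : l2norm (fun g => (ξ g : ℝ≥0∞)) ≠ ⊤) :
    Memℓp (fun g => ((ξ g : ℝ) : ℂ)) 2 := by
  rw [memℓp_gen_iff (by norm_num)]
  have hsq : ∑' g, (ξ g : ℝ≥0∞) ^ 2 ≠ ⊤ :=
    l2norm_sq (fun g => (ξ g : ℝ≥0∞)) ▸ ENNReal.pow_ne_top hξ
  refine (ENNReal.summable_toReal hsq).congr fun g => ?_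
  simp

variable [Group G]

theorem regularRep_apply (x : MonoidAlgebra ℂ G) (ξ : L2 G) (u : G) :
    (regularRep x ξ : G → ℂ) u = ∑ g ∈ x.coeff.support, x.coeff g * ξ (g⁻¹ * u) := by
  rw [regularRep, sum_apply, lp.coeFn_sum, Finset.sum_apply]
  rfl

theorem tsum_mul_translate (ξ η : G → ℝ≥0∞) (g : G) :
    ∑' h, ξ h * η (g * h) = ∑' u, ξ (g⁻¹ * u) * η u := by
  rw [← (Equiv.mulLeft g).tsum_eq fun u => ξ (g⁻¹ * u) * η u]
  simp only [Equiv.coe_mulLeft, inv_mul_cancel_left]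

theorem tsum_conv_mul (x ξ η : G → ℝ≥0∞) :
    ∑' g, ∑' h, x g * ξ h * η (g * h) = ∑' u, (∑' g, x g * ξ (g⁻¹ * u)) * η u := by
  simp only [mul_assoc, ENNReal.tsum_mul_left, tsum_mul_translate ξ η]
  simp only [← ENNReal.tsum_mul_left, ← ENNReal.tsum_mul_right, mul_assoc]
  exact ENNReal.tsum_comm

theorem enorm_regularRep_apply_le (x : MonoidAlgebra ℂ G) (ξ : L2 G) (u : G) :
    ‖regularRep x ξ u‖ₑ ≤ ∑' g, ‖x.coeff g‖ₑ * ‖ξ (g⁻¹ * u)‖ₑ := by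
  rw [regularRep_apply]
  refine (enorm_sum_le _ _).trans ?_
  simp only [enorm_mul]
  exact ENNReal.sum_le_tsum _

theorem le_of_mul_self_le_mul {a c : ℝ≥0∞} (ha : a ≠ ⊤) (h : a * a ≤ c * a) : a ≤ c := by
  obtain rfl | ha₀ := eq_or_ne a 0
  · exact zero_le
  · exact (ENNReal.mul_le_mul_iff_left ha₀ ha).1 h

variable {S : Set G} {K : ℝ≥0}

theorem ConvolutionBound.opNorm_le (hS : ConvolutionBound S K) {x : MonoidAlgebra ℂ G}
    (hx : ∀ g ∈ x.coeff.support, g ∈ S) : opNorm x ≤ K * twoNorm x := by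
  refine ContinuousLinearMap.opNorm_le_bound _ (mul_nonneg K.coe_nonneg (twoNorm_nonneg x))
    fun ξ => ?_
  have henorm : ‖regularRep x ξ‖ₑ ≤ K * ENNReal.ofReal (twoNorm x) * ‖ξ‖ₑ := by
    refine le_of_mul_self_le_mul enorm_ne_top ?_
    calc ‖regularRep x ξ‖ₑ * ‖regularRep x ξ‖ₑ
        = ∑' u, ‖regularRep x ξ u‖ₑ * ‖regularRep x ξ u‖ₑ := by
          rw [enorm_eq_l2norm, ← sq, l2norm_sq]
          simp only [sq]
      _ ≤ ∑' u, (∑' g, ‖x.coeff g‖ₑ * ‖ξ (g⁻¹ * u)‖ₑ) * ‖regularRep x ξ u‖ₑ := by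
          gcongr with u
          exact enorm_regularRep_apply_le x ξ u
      _ ≤ K * (l2norm fun g => ‖x.coeff g‖ₑ) * (l2norm fun g => ‖ξ g‖ₑ) *
            l2norm fun g => ‖regularRep x ξ g‖ₑ := by
          rw [← tsum_conv_mul (fun g => ‖x.coeff g‖ₑ) fun g => ‖ξ g‖ₑ]
          exact hS _ _ _ fun g hg => hx g (by simpa using hg)
      _ = K * ENNReal.ofReal (twoNorm x) * ‖ξ‖ₑ * ‖regularRep x ξ‖ₑ := by
          simp only [ofReal_twoNorm, enorm_eq_l2norm]
  simpa [ENNReal.toReal_ofReal (twoNorm_nonneg x)] using ENNReal.toReal_mono (by finiteness) henorm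

theorem enorm_regularRep_complexify (x : G →₀ ℝ≥0) {ξ : G → ℝ≥0} {ξ' : L2 G}
    (hξ : ∀ g, ξ' g = ((ξ g : ℝ) : ℂ)) (u : G) :
    ‖regularRep (complexify x) ξ' u‖ₑ = ∑' g, (x g : ℝ≥0∞) * ξ (g⁻¹ * u) := by
  have hcoe : regularRep (complexify x) ξ' u =
      (((∑ g ∈ x.support, x g * ξ (g⁻¹ * u) : ℝ≥0) : ℝ) : ℂ) := by
    rw [regularRep_apply, support_complexify]
    push_cast
    exact Finset.sum_congr rfl fun g _ => by rw [hξ]; rfl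
  rw [hcoe, enorm_ofReal_coe, tsum_eq_sum (s := x.support)]
  · push_cast
    rfl
  · intro g hg
    rw [Finsupp.notMem_support_iff.1 hg, ENNReal.coe_zero, zero_mul]

theorem l2norm_conv_le (hS : ∀ x : MonoidAlgebra ℂ G, (∀ g ∈ x.coeff.support, g ∈ S) →
    opNorm x ≤ K * twoNorm x) (x : G →₀ ℝ≥0) (hx : ∀ g, x g ≠ 0 → g ∈ S) {ξ : G → ℝ≥0}
    (hξ : l2norm (fun g => (ξ g : ℝ≥0∞)) ≠ ⊤) :
    (l2norm fun u => ∑' g, (x g : ℝ≥0∞) * ξ (g⁻¹ * u)) ≤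
      K * (l2norm fun g => (x g : ℝ≥0∞)) * l2norm fun g => (ξ g : ℝ≥0∞) := by
  let ξ' : L2 G := ⟨_, memLp_of_l2norm_ne_top hξ⟩
  have hopNorm : opNorm (complexify x) ≤ K * twoNorm (complexify x) :=
    hS _ fun g hg => hx g (Finsupp.mem_support_iff.1 (support_complexify x ▸ hg))
  calc (l2norm fun u => ∑' g, (x g : ℝ≥0∞) * ξ (g⁻¹ * u))
      = ‖regularRep (complexify x) ξ'‖ₑ := by
        rw [enorm_eq_l2norm]
        exact congrArg l2norm
          (funext fun u => (enorm_regularRep_complexify x (fun _ => rfl) u).symm)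
    _ ≤ ENNReal.ofReal (opNorm (complexify x)) * ‖ξ'‖ₑ := by
        rw [opNorm, ofReal_norm]
        exact (regularRep (complexify x)).le_opENorm ξ'
    _ ≤ ENNReal.ofReal (K * twoNorm (complexify x)) * ‖ξ'‖ₑ := by gcongr
    _ = K * (l2norm fun g => (x g : ℝ≥0∞)) * l2norm fun g => (ξ g : ℝ≥0∞) := by
        rw [ENNReal.ofReal_mul K.coe_nonneg, ENNReal.ofReal_coe_nnreal, ofReal_twoNorm_complexify,
          enorm_eq_l2norm]
        exact congrArg _ (congrArg l2norm (funext fun g => enorm_ofReal_coe (ξ g)))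

theorem sum_tsum_le_of_opNorm_le (hS : ∀ x : MonoidAlgebra ℂ G,
    (∀ g ∈ x.coeff.support, g ∈ S) → opNorm x ≤ K * twoNorm x) {x ξ : G → ℝ≥0} (η : G → ℝ≥0∞)
    (hx : ∀ g, x g ≠ 0 → g ∈ S) (hξ : l2norm (fun g => (ξ g : ℝ≥0∞)) ≠ ⊤) (A : Finset G) :
    ∑ g ∈ A, ∑' h, x g * ξ h * η (g * h) ≤
      K * (l2norm fun g => (x g : ℝ≥0∞)) * (l2norm fun g => (ξ g : ℝ≥0∞)) * l2norm η := by
  classical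
  let y : G →₀ ℝ≥0 := Finsupp.indicator A fun g _ => x g
  have hy : ∀ g, y g = if g ∈ A then x g else 0 := fun g => Finsupp.indicator_apply ..
  have hy_le : ∀ g, y g ≤ x g := fun g => by
    rw [hy]
    split_ifs
    exacts [le_rfl, zero_le]
  calc ∑ g ∈ A, ∑' h, x g * ξ h * η (g * h)
      = ∑' g, ∑' h, y g * ξ h * η (g * h) := by
        rw [tsum_eq_sum (s := A)]
        · exact Finset.sum_congr rfl fun g hg => by rw [hy, if_pos hg]
        · intro g hg
          simp [hy, hg]
    _ = ∑' u, (∑' g, (y g : ℝ≥0∞) * ξ (g⁻¹ * u)) * η u := tsum_conv_mul _ _ _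
    _ ≤ (l2norm fun u => ∑' g, (y g : ℝ≥0∞) * ξ (g⁻¹ * u)) * l2norm η := tsum_mul_le_l2norm_mul _ _
    _ ≤ K * (l2norm fun g => (y g : ℝ≥0∞)) * (l2norm fun g => (ξ g : ℝ≥0∞)) * l2norm η := by
        gcongr
        exact l2norm_conv_le hS y
          (fun g hg => hx g ((pos_iff_ne_zero.2 hg).trans_le (hy_le g)).ne') hξ
    _ ≤ K * (l2norm fun g => (x g : ℝ≥0∞)) * (l2norm fun g => (ξ g : ℝ≥0∞)) * l2norm η := by
        gcongr
        refine l2norm_le_l2norm ?_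
        gcongr with g
        exact hy_le g

theorem ConvolutionBound.of_opNorm_le (hK : K ≠ 0) (hS : ∀ x : MonoidAlgebra ℂ G,
    (∀ g ∈ x.coeff.support, g ∈ S) → opNorm x ≤ K * twoNorm x) : ConvolutionBound S K := by
  intro x ξ η hx
  have hK' : (K : ℝ≥0∞) ≠ 0 := ENNReal.coe_ne_zero.2 hK
  obtain hx₀ | hx₀ := eq_or_ne (l2norm x) 0
  · simp [l2norm_eq_zero.1 hx₀]
  obtain hξ₀ | hξ₀ := eq_or_ne (l2norm ξ) 0
  · simp [l2norm_eq_zero.1 hξ₀]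
  obtain hη₀ | hη₀ := eq_or_ne (l2norm η) 0
  · simp [l2norm_eq_zero.1 hη₀]
  obtain hx_top | hx_top := eq_or_ne (l2norm x) ⊤
  · simp [hx_top, hK', hξ₀, hη₀, ENNReal.mul_top, ENNReal.top_mul]
  obtain hξ_top | hξ_top := eq_or_ne (l2norm ξ) ⊤
  · simp [hξ_top, hK', hx₀, hη₀, ENNReal.mul_top, ENNReal.top_mul]
  lift x to G → ℝ≥0 using apply_ne_top_of_l2norm_ne_top hx_top
  lift ξ to G → ℝ≥0 using apply_ne_top_of_l2norm_ne_top hξ_top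
  rw [ENNReal.tsum_eq_iSup_sum]
  exact iSup_le fun A => sum_tsum_le_of_opNorm_le hS η
    (fun g hg => hx g (ENNReal.coe_ne_zero.2 hg)) hξ_top A

end RegularRep

/-! ### Convolution bounds from splittings -/

section Splitting

variable {A B C G H : Type*} [Group G] [Group H] {S : Set G} {S' : Set H} {K : ℝ≥0∞}

theorem ConvolutionBound.tsum_kernel_le (hS : ConvolutionBound S' K)
    {x : (A × C) × H → ℝ≥0∞} (hx : ∀ p s, x (p, s) ≠ 0 → s ∈ S') (ξ : (C × B) × H → ℝ≥0∞)
    (η : (A × B) × H → ℝ≥0∞) :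
    ∑' a, ∑' c, ∑' b, ∑' s, ∑' t, x ((a, c), s) * ξ ((c, b), t) * η ((a, b), s * t) ≤
      K * (l2norm x * l2norm ξ * l2norm η) := by
  calc ∑' a, ∑' c, ∑' b, ∑' s, ∑' t, x ((a, c), s) * ξ ((c, b), t) * η ((a, b), s * t)
      ≤ ∑' a, ∑' c, ∑' b, K * l2norm (fun s => x ((a, c), s)) * l2norm (fun t => ξ ((c, b), t)) *
          l2norm (fun s => η ((a, b), s)) := by
        gcongr with a c b
        exact hS _ _ _ (hx (a, c))
    _ = K * ∑' a, ∑' c, ∑' b, l2norm (fun s => x ((a, c), s)) * l2norm (fun t => ξ ((c, b), t)) *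
          l2norm (fun s => η ((a, b), s)) := by
        simp only [mul_assoc, ENNReal.tsum_mul_left]
    _ ≤ K * (l2norm x * l2norm ξ * l2norm η) := by
        gcongr
        simpa only [l2norm_prod] using tsum_triangle_le (fun p => l2norm fun s => x (p, s))
          (fun p => l2norm fun t => ξ (p, t)) fun p => l2norm fun s => η (p, s)

/-- Every product `g * h` with `g ∈ S` can be written as `(a s c) (c⁻¹ t b) = a (s t) b` with middle
factors `s`, `t` in `H`, where `μ i ((a, b), s)` stands for `a s b` and the family `D` records which
factorizations are admitted. -/
def SplitsProducts {ι : Type*} (D : ι → Set ((G × G) × H)) (μ : ι → (G × G) × H → G) (S : Set G) :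
    Prop :=
  ∀ g ∈ S, ∀ h, ∃ i j a b c s t, (((a, c), s) ∈ D i ∧ μ i ((a, c), s) = g) ∧
    (((c⁻¹, b), t) ∈ D j ∧ μ j ((c⁻¹, b), t) = h) ∧ ((a, b), s * t) ∈ D i ∧
    μ i ((a, b), s * t) = g * h

variable {ι : Type*} {D : ι → Set ((G × G) × H)} {μ : ι → (G × G) × H → G}

theorem SplitsProducts.tsum_conv_le (hsplit : SplitsProducts D μ S) {x : G → ℝ≥0∞}
    (hx : ∀ g, x g ≠ 0 → g ∈ S) (ξ η : G → ℝ≥0∞) :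
    ∑' g, ∑' h, x g * ξ h * η (g * h) ≤ ∑' i, ∑' j, ∑' a, ∑' c, ∑' b, ∑' s, ∑' t,
      (D i).indicator (x ∘ μ i) ((a, c), s) * (D j).indicator (ξ ∘ μ j) ((c⁻¹, b), t) *
        (D i).indicator (η ∘ μ i) ((a, b), s * t) := by
  have indicator_of_mem {f : G → ℝ≥0∞} {i : ι} {q : (G × G) × H} {g : G}
      (hq : q ∈ D i ∧ μ i q = g) : (D i).indicator (f ∘ μ i) q = f g := by
    rw [Set.indicator_of_mem hq.1, Function.comp_apply, hq.2]
  let summand : ι × ι × G × G × G × H × H → ℝ≥0∞ := fun (i, j, a, c, b, s, t) =>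
    (D i).indicator (x ∘ μ i) ((a, c), s) * (D j).indicator (ξ ∘ μ j) ((c⁻¹, b), t) *
      (D i).indicator (η ∘ μ i) ((a, b), s * t)
  have hle : ∑' p : G × G, x p.1 * ξ p.2 * η (p.1 * p.2) ≤ ∑' q, summand q := by
    refine tsum_le_tsum_of_forall_exists
      (fun (i, j, a, c, b, s, t) => (μ i ((a, c), s), μ j ((c⁻¹, b), t))) ?_
    rintro ⟨g, h⟩ hgh
    obtain ⟨i, j, a, b, c, s, t, hg, hh, hmul⟩ :=
      hsplit g (hx g (left_ne_zero_of_mul (left_ne_zero_of_mul hgh))) h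
    refine ⟨(i, j, a, c, b, s, t), Prod.ext hg.2 hh.2, le_of_eq ?_⟩
    simp only [summand, indicator_of_mem hg, indicator_of_mem hh, indicator_of_mem hmul]
  simpa only [ENNReal.tsum_prod', summand] using hle

theorem ConvolutionBound.of_splitsProducts [Finite ι] (hS' : ConvolutionBound S' K)
    (hsplit : SplitsProducts D μ S) (hinj : ∀ i, (D i).InjOn (μ i))
    (hD : ∀ i, ∀ q ∈ D i, μ i q ∈ S → q.2 ∈ S') :
    ConvolutionBound S (Nat.card ι ^ 2 * K) := by
  have := Fintype.ofFinite ι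
  intro x ξ η hx
  have hx_supp (i : ι) (p : G × G) (s : H) (h : (D i).indicator (x ∘ μ i) (p, s) ≠ 0) : s ∈ S' := by
    obtain ⟨hmem, hne⟩ := Set.indicator_apply_ne_zero.1 h
    exact hD i _ hmem (hx _ hne)
  let invFst : (G × G) × H ≃ (G × G) × H :=
    ((Equiv.inv G).prodCongr (Equiv.refl G)).prodCongr (Equiv.refl H)
  calc ∑' g, ∑' h, x g * ξ h * η (g * h)
      ≤ ∑' i, ∑' j, ∑' a, ∑' c, ∑' b, ∑' s, ∑' t, (D i).indicator (x ∘ μ i) ((a, c), s) *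
          ((D j).indicator (ξ ∘ μ j) ∘ invFst) ((c, b), t) *
            (D i).indicator (η ∘ μ i) ((a, b), s * t) := hsplit.tsum_conv_le hx ξ η
    _ ≤ ∑' _ : ι, ∑' _ : ι, K * (l2norm x * l2norm ξ * l2norm η) := by
        gcongr with i j
        refine (hS'.tsum_kernel_le (hx_supp i) _ _).trans ?_
        rw [l2norm_comp_equiv]
        gcongr <;> exact l2norm_indicator_comp_le (hinj _) _
    _ = Nat.card ι ^ 2 * K * l2norm x * l2norm ξ * l2norm η := by
        simp only [tsum_fintype, Finset.sum_const, Finset.card_univ, nsmul_eq_mul,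
          Nat.card_eq_fintype_card]
        ring

end Splitting

section GraphProductBound

open GraphProduct

variable {V : Type v} {Γ : SimpleGraph V} {G : V → Type w} [∀ i, Group (G i)]

/-- The admitted splittings of a graph product with cancelling parts of at most `k` syllables are
indexed by the syllable counts of the left part, bounded by `k`, and a list of distinct vertices
for the middle part. -/
abbrev SplittingIndex (V : Type v) (k : ℕ) : Type v :=
  (V → Fin (k + 1)) × {Λ : List V // Λ.Nodup}

theorem card_splittingIndex (V : Type v) [Fintype V] (k : ℕ) : Nat.card (SplittingIndex V k) =
    (k + 1) ^ Fintype.card V * Nat.card {Λ : List V // Λ.Nodup} := by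
  rw [Nat.card_prod, Nat.card_fun, Nat.card_fin, Nat.card_eq_fintype_card]

theorem splitsProducts_splittings {S : Set (GraphProduct Γ G)} {k : ℕ}
    (hk : ∀ g ∈ S, (irreducibleExpr g).length ≤ k) :
    SplitsProducts (fun i : SplittingIndex V k => splittings Γ i.2.1 fun v => i.1 v)
      (fun i => glue Γ i.2.1) S := by
  intro g hg h
  obtain ⟨m, n, Λ, a, c, b, s, t, hm, hn, hΛ, hsplit⟩ :=
    exists_splitting g h (isIrreducible_irreducibleExpr g) (eval_irreducibleExpr g)
  have hlt : ∀ {j}, j ≤ (irreducibleExpr g).length → j < k + 1 :=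
    fun hj => Nat.lt_succ_of_le (hj.trans (hk g hg))
  have hnodup : Λ.Nodup := hΛ.imp SimpleGraph.Adj.ne
  exact ⟨(fun v => ⟨m v, hlt (hm v)⟩, ⟨Λ, hnodup⟩), (fun v => ⟨n v, hlt (hn v)⟩, ⟨Λ, hnodup⟩),
    a, b, c, s, t, hsplit⟩

theorem ConvolutionBound.graphProduct [Fintype V] {l : ∀ i, GroupSeminorm (G i)} {r : ℝ} {k : ℕ}
    {K : V → ℝ≥0∞} (hK : ∀ i, ConvolutionBound {g | l i g ≤ r} (K i))
    (hk : ∀ g : GraphProduct Γ G, length Γ l g ≤ r → (irreducibleExpr g).length ≤ k) :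
    ConvolutionBound {g | length Γ l g ≤ r}
      (((k + 1) ^ Fintype.card V * Nat.card {Λ : List V // Λ.Nodup} : ℕ) ^ 2 * ∏ i, K i) := by
  classical
  rw [← card_splittingIndex]
  exact (ConvolutionBound.pi hK).of_splitsProducts (splitsProducts_splittings hk)
    (fun i => injOn_glue Γ i.2.1 _) fun i q hq hr v _ => (le_length_glue l hq v).trans hr

end GraphProductBound

/-! ### Subexponential functions -/

section Subexponential

variable {f g : ℕ → ℝ≥0}

theorem IsSubexponential.mul (hf : IsSubexponential f) (hg : IsSubexponential g) :
    IsSubexponential fun n => f n * g n := by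
  simpa only [IsSubexponential, NNReal.mul_rpow, mul_one] using Tendsto.mul hf hg

theorem isSubexponential_const {c : ℝ≥0} (hc : c ≠ 0) : IsSubexponential fun _ => c := by
  simpa only [IsSubexponential, NNReal.rpow_zero] using
    (tendsto_const_nhds (x := c)).nnrpow tendsto_one_div_atTop_nhds_zero_nat (Or.inl hc)

theorem IsSubexponential.pow (hf : IsSubexponential f) (k : ℕ) :
    IsSubexponential fun n => f n ^ k := by
  induction k with
  | zero => simpa only [pow_zero] using isSubexponential_const one_ne_zero
  | succ k ih => simpa only [pow_succ] using ih.mul hf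

theorem IsSubexponential.prod {ι : Type*} (s : Finset ι) {f : ι → ℕ → ℝ≥0}
    (hf : ∀ i, IsSubexponential (f i)) : IsSubexponential fun n => ∏ i ∈ s, f i n := by
  classical
  induction s using Finset.induction_on with
  | empty => simpa only [Finset.prod_empty] using isSubexponential_const one_ne_zero
  | insert i s hi ih => simpa only [Finset.prod_insert hi] using (hf i).mul ih

theorem IsSubexponential.one_max (hf : IsSubexponential f) :
    IsSubexponential fun n => max 1 (f n) := by
  have hmax := Tendsto.max (tendsto_const_nhds (x := (1 : ℝ≥0))) hf
  rw [max_self] at hmax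
  refine hmax.congr fun n => ?_
  rw [(NNReal.monotone_rpow_of_nonneg (by positivity)).map_max, NNReal.one_rpow]

theorem IsSubexponential.of_le (hg : IsSubexponential g) (hf : ∀ n, 1 ≤ f n)
    (hfg : ∀ n, f n ≤ g n) : IsSubexponential f :=
  tendsto_of_tendsto_of_tendsto_of_le_of_le tendsto_const_nhds hg
    (fun n => NNReal.one_le_rpow (hf n) (by positivity))
    (fun n => NNReal.rpow_le_rpow (hfg n) (by positivity))

theorem isSubexponential_add_one : IsSubexponential fun n => (n : ℝ≥0) + 1 := by
  have h := (tendsto_rpow_div_mul_add 1 1 (-1) zero_ne_one).comp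
    (tendsto_atTop_add_const_right atTop (1 : ℝ) tendsto_natCast_atTop_atTop)
  rw [IsSubexponential, ← NNReal.tendsto_coe]
  refine h.congr fun n => ?_
  simp

theorem isSubexponential_linear (M : ℕ) : IsSubexponential fun n => (M : ℝ≥0) * n + 1 := by
  refine ((isSubexponential_const (c := (M : ℝ≥0) + 1) (by positivity)).mul
    isSubexponential_add_one).of_le (fun n => le_add_self) fun n => ?_
  rw [add_mul, one_mul, mul_add, mul_one, add_assoc]
  gcongr
  exact le_add_self.trans le_add_self

end Subexponential

/-! ### Subexponential decay of graph products -/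

section Main

open GraphProduct

theorem HasSDWith.mono {G : Type u} [Group G] {l l' : GroupSeminorm G} (h : HasSDWith l)
    (hle : ∀ g, l g ≤ l' g) : HasSDWith l' := by
  obtain ⟨hcount, f, hf, hdecay⟩ := h
  exact ⟨hcount, f, hf, fun D x hx => hdecay D x fun g hg => (hle g).trans (hx g hg)⟩

theorem IsDecayFunction.convolutionBound {G : Type u} [Group G] {l : GroupSeminorm G}
    {f : ℕ → ℝ≥0} (h : IsDecayFunction l f) (D : ℕ) :
    ConvolutionBound {g | l g ≤ D} (max 1 (f D) : ℝ≥0) := by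
  refine .of_opNorm_le (by positivity) fun x hx => (h D x hx).trans ?_
  gcongr
  exacts [twoNorm_nonneg x, le_max_right _ _]

variable {V : Type v} [Finite V] {G : V → Type w} [∀ i, Group (G i)]
  {l : ∀ i, GroupSeminorm (G i)}

theorem exists_nat_forall_one_le_mul (hc : ∀ i, ∃ c : ℝ, 0 < c ∧ ∀ g : G i, g ≠ 1 → c ≤ l i g) :
    ∃ M : ℕ, ∀ i, ∀ g : G i, g ≠ 1 → 1 ≤ M * l i g := by
  choose c hpos hle using hc
  obtain ⟨M, hM⟩ := Finite.exists_le fun i => ⌈1 / c i⌉₊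
  refine ⟨M, fun i g hg => ?_⟩
  calc (1 : ℝ) ≤ M * c i := (div_le_iff₀ (hpos i)).1 (Nat.ceil_le.1 (hM i))
    _ ≤ M * l i g := by
        gcongr
        exact hle i g hg

theorem HasSDWith.graphProduct (Γ : SimpleGraph V) (hl : ∀ i, HasSDWith (l i))
    (hc : ∀ i, ∃ c : ℝ, 0 < c ∧ ∀ g : G i, g ≠ 1 → c ≤ l i g) : HasSDWith (length Γ l) := by
  have := Fintype.ofFinite V
  choose hcount f hf hdecay using hl
  obtain ⟨M, hM⟩ := exists_nat_forall_one_le_mul hc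
  let N := Nat.card {Λ : List V // Λ.Nodup}
  have hN : (N : ℝ≥0) ≠ 0 := by
    have : Nonempty {Λ : List V // Λ.Nodup} := ⟨⟨[], List.nodup_nil⟩⟩
    exact Nat.cast_ne_zero.2 Nat.card_pos.ne'
  refine ⟨eval_surjective.countable, fun D => (((M * D : ℕ) + 1) ^ Fintype.card V * N) ^ 2 *
    ∏ i, max 1 (f i D), ?subexponential, fun D x hx => ?decay⟩
  case subexponential =>
    simp only [Nat.cast_mul]
    exact ((((isSubexponential_linear M).pow _).mul (isSubexponential_const hN)).pow 2).mul
      (.prod _ fun i => (hf i).one_max)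
  case decay =>
    have hbound := ConvolutionBound.graphProduct (Γ := Γ) (k := M * D)
      (fun i => (hdecay i).convolutionBound D) fun g hg => by
        have hlen := (isIrreducible_irreducibleExpr g).length_le_mul_weight hM
        exact_mod_cast hlen.trans (mul_le_mul_of_nonneg_left hg M.cast_nonneg)
    exact ConvolutionBound.opNorm_le (by exact_mod_cast hbound) hx

theorem HasSD.graphProduct (Γ : SimpleGraph V) (h : ∀ i, HasSD (G i)) :
    HasSD (GraphProduct Γ G) := by
  classical
  choose l hl using h
  refine ⟨length Γ fun i => l i + 1, .graphProduct Γ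
    (fun i => (hl i).mono fun g => le_add_of_nonneg_right (apply_nonneg 1 g))
    fun i => ⟨1, one_pos, fun g hg => ?_⟩⟩
  rw [add_apply, GroupSeminorm.apply_one, if_neg hg]
  exact le_add_of_nonneg_left (apply_nonneg _ _)

end Main

end SubexpDecay

end

theorem mainTheorem6 {V : Type v} [Finite V] (Γ : SimpleGraph V) (G : V → Type w)
    [∀ i, Group (G i)] :
    ((∀ i, SubexpDecay.HasSD (G i)) → SubexpDecay.HasSD (SubexpDecay.GraphProduct Γ G)) ∧
    (∀ l : ∀ i, GroupSeminorm (G i),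
      (∀ i, SubexpDecay.HasSDWith (l i)) →
      (∀ i, ∃ c : ℝ, 0 < c ∧ ∀ g : G i, g ≠ 1 → c ≤ l i g) →
      ∃ L : GroupSeminorm (SubexpDecay.GraphProduct Γ G),
        (∀ e : List (Σ i, G i), SubexpDecay.GraphProduct.IsReduced Γ e →
          L (SubexpDecay.GraphProduct.eval Γ e) = (e.map fun y => l y.1 y.2).sum) ∧
        SubexpDecay.HasSDWith L) := by
  exact ⟨.graphProduct Γ, fun l hl hc => ⟨SubexpDecay.GraphProduct.length Γ l,
    fun _ he => he.isIrreducible.length_eval l, .graphProduct Γ hl hc⟩⟩
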